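/- All graphs are finite, simple and undirected (not necessarily connected), and $P_m$ denotes the path on $m$ vertices; a graph is $P_m$-free if it has no induced subgraph isomorphic to $P_m$. Fix $c \in \mathbb{N}$. In an $n$-vertex network the vertices carry pairwise distinct identifiers from $\{1,\dots,n^c\}$. A certificate is a finite bit string attached to a vertex; its size is its length. The view at distance $d$ of a vertex $v$ consists of the identifier of $v$, the vertices at distance at most $d$ from $v$, each given by its identifier and its certificate, and the edges between these vertices, except those joining two vertices at distance exactly $d$ from $v$. A graph property $\mathcal{P}$ has a local certification of size $s : \mathbb{N} \to \mathbb{N}$ with verification radius $d$ if there is a verification algorithm, i.e. a map from views at distance $d$ to $\{\text{accept}, \text{reject}\}$ (the same for all networks; it is not given $n$), such that for every $n \in \mathbb{N}$, every $n$-vertex graph $G$ and every assignment of identifiers as above: - if $G$ satisfies $\mathcal{P}$, then there is an assignment of certificates of size at most $s(n)$ for which every vertex accepts; - if $G$ does not satisfy $\mathcal{P}$, then for every assignment of certificates (of any size) at least one vertex rejects. **Theorem.** For every $c \in \mathbb{N}$ there is a function $s : \mathbb{N} \to \mathbb{N}$ with $s(n) = O(n^{3/2} \log^2 n)$ as $n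 \to \infty$ such that, for every integer $k \ge 1$, the property of being $P_{4k-1}$-free has a local certification of size $s$ with verification radius $k$. (In particular the constant in the $O$ does not depend on $k$.) -/

import Mathlib

/-- A property of (simple, undirected) graphs; it is only ever evaluated on finite graphs. -/
abbrev GraphProperty : Type 1 := ∀ V : Type, SimpleGraph V → Prop

/-- `G` is `P_m`-free: it has no induced subgraph isomorphic to the path on `m` vertices. -/
def IsInducedPathFree (m : ℕ) : GraphProperty :=
  fun _ G => ¬ (SimpleGraph.pathGraph m).IsIndContained G

/-- What a node gets to see: its own identifier, the identifiers and certificates (bit strings) of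
the visible vertices, and the visible edges, written as ordered pairs of identifiers in both
orders.  Neither the number of vertices of the network nor the vertices themselves are part
of it. -/
@[ext]
structure LocalView where
  center : ℕ
  labels : Set (ℕ × List Bool)
  edges : Set (ℕ × ℕ)

/-- The view at distance `d` of the vertex `v`: the vertices at distance at most `d` from `v`, with
their identifiers and certificates, and the edges between these vertices, except the ones between
two vertices at distance exactly `d`. The distance `edist` is infinite between vertices in
different connected components. -/
def localView {V : Type} (G : SimpleGraph V) (ident : V → ℕ) (cert : V → List Bool) (d : ℕ)
    (v : V) : LocalView where
  center := ident v
  labels := {p | ∃ w, G.edist v w ≤ d ∧ p = (ident w, cert w)}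
  edges := {p | ∃ a b, G.Adj a b ∧ G.edist v a ≤ d ∧ G.edist v b ≤ d ∧
    ¬ (G.edist v a = d ∧ G.edist v b = d) ∧ p = (ident a, ident b)}

/-- The vertices carry pairwise distinct identifiers in `{1, …, n ^ c}`, where `n` is the number of
vertices, that is, unique identifiers on `O(log n)` bits. -/
def IsIdentifierAssignment (c : ℕ) {V : Type} [Fintype V] (ident : V → ℕ) : Prop :=
  Function.Injective ident ∧ ∀ v, 1 ≤ ident v ∧ ident v ≤ Fintype.card V ^ c

/-- There is a local certification of size `s` with verification radius `d` for the property `P`,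
on networks whose identifiers range in `{1, …, n ^ c}`. One verification algorithm, a function of
the view alone (`true` is accept and `false` is reject), serves all networks. -/
def HasLocalCertification (c : ℕ) (s : ℕ → ℕ) (d : ℕ) (P : GraphProperty) : Prop :=
  ∃ verify : LocalView → Bool,
    ∀ (V : Type) [Fintype V] (G : SimpleGraph V) (ident : V → ℕ), IsIdentifierAssignment c ident →
      (P V G → ∃ cert : V → List Bool, (∀ v, (cert v).length ≤ s (Fintype.card V)) ∧
        ∀ v, verify (localView G ident cert d v) = true) ∧
      (¬ P V G → ∀ cert : V → List Bool, ∃ v, verify (localView G ident cert d v) = false)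

/-!
Let the radius be `r + 1` with `r ≥ 1`; radius `1` is elementary, as a graph is `P_3`-free when
adjacent vertices have the same closed neighbourhood. Call a vertex high if its degree is at least
`√n`, and put two high vertices in the same cluster when they are joined by a sequence of high
vertices with steps of length at most `2r`. Neighbourhoods of distinct clusters are disjoint, so
there are at most about `√n` clusters. A map of size `n^{3/2}`, up to logarithms, lists the
adjacencies of the vertices outside the clusters and, for each cluster and each vertex, the distance
between them. It is part of all certificates, and it misses only the adjacencies inside a cluster.

To supply these, the rows of the adjacency matrix are split into about `√n / log n` groups, and a
random colouring of the vertices tells each of them which group to store. A high vertex has so many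
neighbours that it reads all the rows from them. The rows read by two high vertices at distance at
most `2r` are compared by a vertex halfway between them, and doing so along a spanning tree of a
cluster shows that all its members read the same rows; these are correct, as every member checks
its own.

Hence the members of a cluster detect an induced path of order `4r + 3` unless it meets another
cluster twice. Since clusters are at distance at least `2r + 1`, a path that no vertex detects meets
exactly two clusters `A` and `B`, first `A` twice and then `B` twice. It is then so short that some
level of the distance to `B` is attained exactly once on it. What precedes this vertex is farther
from `B`, what follows is closer, and the two parts are known to `A` and to `B` respectively. It is
therefore enough that the map gives, for each vertex `v`, the order of a longest induced path which
starts at `v` and then stays closer to `B`. A member of `B` checks that this number is not too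
small, and a member of `A` that no path known to `A` which ends at `v`, and is farther from `B`
before, is extended by it to the order `4r + 3`.
-/

/-! ### Encoding finite sets as bit strings -/

/-- A self-delimiting encoding of bit strings: each bit is preceded by a continuation mark
`true`. -/
def selfDelimiting : List Bool → List Bool
  | [] => [false]
  | b :: l => true :: b :: selfDelimiting l

theorem length_selfDelimiting (l : List Bool) : (selfDelimiting l).length = 2 * l.length + 1 := by
  induction l with
  | nil => rfl
  | cons b l ih => simp only [selfDelimiting, List.length_cons, ih]; ring

theorem selfDelimiting_append_inj {l l' r r' : List Bool}
    (h : selfDelimiting l ++ r = selfDelimiting l' ++ r') : l = l' ∧ r = r' := by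
  induction l generalizing l' with
  | nil => cases l' <;> simp_all [selfDelimiting]
  | cons b l ih =>
    cases l' with
    | nil => simp [selfDelimiting] at h
    | cons b' l' =>
      simp only [selfDelimiting, List.cons_append, List.cons.injEq, true_and] at h
      obtain ⟨h₁, h₂⟩ := ih h.2
      exact ⟨by rw [h.1, h₁], h₂⟩

theorem flatMap_selfDelimiting_injective :
    Function.Injective fun L : List (List Bool) => L.flatMap selfDelimiting := by
  have ne_nil (l : List Bool) : selfDelimiting l ≠ [] := by cases l <;> simp [selfDelimiting]
  intro L L' h
  induction L generalizing L' with
  | nil => cases L' <;> simp_all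
  | cons l L ih =>
    cases L' with
    | nil => simp [ne_nil] at h
    | cons l' L' =>
      simp only [List.flatMap_cons] at h
      obtain ⟨rfl, htail⟩ := selfDelimiting_append_inj h
      rw [ih htail]

theorem bits_injective : Function.Injective Nat.bits := fun m n h =>
  Nat.digits_inj_iff.1 (by rw [Nat.digits_two_eq_bits, Nat.digits_two_eq_bits, h])

/-- A bit string representing a finite set whose elements are numbered by `f`. -/
noncomputable def encodeFinset {α : Type*} (f : α ↪ ℕ) (S : Finset α) : List Bool :=
  (S.toList.map fun a => (f a).bits).flatMap selfDelimiting

theorem encodeFinset_injective {α : Type*} (f : α ↪ ℕ) :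
    Function.Injective (encodeFinset f) := by
  classical
  intro S T h
  have hmap := flatMap_selfDelimiting_injective h
  rw [← S.toList_toFinset, ← T.toList_toFinset,
    (bits_injective.comp f.injective).list_map hmap]

theorem length_encodeFinset_le {α : Type*} {f : α ↪ ℕ} {S : Finset α} {s : ℕ}
    (h : ∀ a ∈ S, f a < 2 ^ s) : (encodeFinset f S).length ≤ S.card * (2 * s + 1) := by
  rw [encodeFinset, List.length_flatMap]
  refine (List.sum_le_card_nsmul _ (2 * s + 1) ?_).trans (by simp)
  simp only [List.map_map, List.mem_map, Finset.mem_toList, Function.comp_apply,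
    length_selfDelimiting, forall_exists_index, and_imp]
  rintro _ a ha rfl
  have := Nat.size_le.2 (h a ha)
  rw [Nat.size_eq_bits_len]
  lia

theorem hasLocalCertification_of_encoding {α : Type*} {c d : ℕ} {s : ℕ → ℕ} {P : GraphProperty}
    (encode : α → List Bool) (accepts : LocalView → Prop)
    (complete : ∀ (V : Type) [Fintype V] (G : SimpleGraph V) (ident : V → ℕ),
      IsIdentifierAssignment c ident → P V G →
        ∃ F : V → α, (∀ v, (encode (F v)).length ≤ s (Fintype.card V)) ∧
          ∀ v, accepts (localView G ident (encode ∘ F) d v))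
    (sound : ∀ (V : Type) [Fintype V] (G : SimpleGraph V) (ident : V → ℕ),
      Function.Injective ident → ∀ F : V → α,
        (∀ v, accepts (localView G ident (encode ∘ F) d v)) → P V G) :
    HasLocalCertification c s d P := by
  classical
  refine ⟨fun W => decide ((∃ a, (W.center, encode a) ∈ W.labels) ∧ accepts W),
    fun V _ G ident hident => ⟨fun hP => ?_, fun hP cert => ?_⟩⟩
  · obtain ⟨F, hsize, haccepts⟩ := complete V G ident hident hP
    exact ⟨encode ∘ F, hsize, fun v => decide_eq_true ⟨⟨F v, v, by simp, rfl⟩, haccepts v⟩⟩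
  · by_contra! hall
    simp only [ne_eq, Bool.not_eq_false, decide_eq_true_eq] at hall
    have hcode (v : V) : ∃ a, cert v = encode a := by
      obtain ⟨a, w, -, hw⟩ := (hall v).1
      obtain ⟨hv, ha⟩ := Prod.ext_iff.1 hw
      exact ⟨a, by rw [hident.1 hv]; exact ha.symm⟩
    choose F hF using hcode
    obtain rfl : cert = encode ∘ F := funext hF
    exact hP (sound V G ident hident.1 F fun v => (hall v).2)

/-! ### Colourings -/

theorem two_mul_pow_pred_le {m : ℕ} (hm : 0 < m) : 2 * (m - 1) ^ m ≤ m ^ m := by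
  obtain ⟨l, rfl⟩ := Nat.exists_eq_succ_of_ne_zero hm.ne'
  rcases Nat.eq_zero_or_pos l with rfl | hl
  · simp
  have hl' : (0 : ℝ) < l := by exact_mod_cast hl
  have bernoulli := one_add_mul_le_pow (a := (1 / l : ℝ)) (by linarith [one_div_pos.2 hl']) (l + 1)
  have two_le : (2 : ℝ) ≤ ((l + 1) / l) ^ (l + 1) := by
    refine le_trans ?_ (bernoulli.trans_eq (by congr 1; field_simp))
    have : (l : ℝ) * (1 / l) = 1 := by field_simp
    push_cast
    linarith [one_div_pos.2 hl']
  rw [div_pow, le_div_iff₀ (by positivity)] at two_le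
  simpa using (by exact_mod_cast two_le : 2 * l ^ (l + 1) ≤ (l + 1) ^ (l + 1))

theorem card_colouring_avoiding_mul_pow {V κ : Type*} [Fintype V] [DecidableEq V] [Fintype κ]
    [DecidableEq κ] (D : Finset V) (i : κ) :
    (Finset.univ.filter fun φ : V → κ => ∀ w ∈ D, φ w ≠ i).card * Fintype.card κ ^ D.card =
      (Fintype.card κ - 1) ^ D.card * Fintype.card κ ^ Fintype.card V := by
  have hpi : (Finset.univ.filter fun φ : V → κ => ∀ w ∈ D, φ w ≠ i) =
      Fintype.piFinset fun w => if w ∈ D then Finset.univ.erase i else Finset.univ := by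
    ext φ
    simp only [Finset.mem_filter, Finset.mem_univ, true_and, Fintype.mem_piFinset]
    refine forall_congr' fun w => ?_
    split_ifs with hw <;> simp [hw]
  have hfactor (w : V) : (if w ∈ D then Finset.univ.erase i else Finset.univ).card =
      if w ∈ D then Fintype.card κ - 1 else Fintype.card κ := by
    split_ifs
    · rw [Finset.card_erase_of_mem (Finset.mem_univ _), Finset.card_univ]
    · rfl
  rw [hpi, Fintype.card_piFinset, Finset.prod_congr rfl fun w _ => hfactor w, Finset.prod_ite,
    Finset.prod_const, Finset.prod_const, mul_assoc, ← pow_add, Finset.filter_univ_mem,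
    ← Finset.card_univ (α := V),
    ← Finset.card_filter_add_card_filter_not (s := Finset.univ) (· ∈ D), Finset.filter_univ_mem,
    add_comm]

theorem exists_colouring_forall_surjOn {V κ ι : Type*} [Finite V] [Fintype κ] [Nonempty κ]
    [Fintype ι] {d : ℕ} (D : ι → Finset V) (hD : ∀ j, d ≤ (D j).card)
    (hd : Fintype.card ι * Fintype.card κ * (Fintype.card κ - 1) ^ d < Fintype.card κ ^ d) :
    ∃ φ : V → κ, ∀ j, Set.SurjOn φ (D j) Set.univ := by
  classical
  cases nonempty_fintype V
  choose D' hsub hcard using fun j => Finset.exists_subset_card_eq (hD j)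
  suffices ∃ φ : V → κ, ∀ p : ι × κ, ¬ ∀ w ∈ D' p.1, φ w ≠ p.2 by
    obtain ⟨φ, hφ⟩ := this
    refine ⟨φ, fun j i _ => ?_⟩
    obtain ⟨w, hw, rfl⟩ : ∃ w ∈ D' j, φ w = i := by simpa using hφ (j, i)
    exact ⟨w, hsub j hw, rfl⟩
  by_contra! hcon
  let avoiding (p : ι × κ) := Finset.univ.filter fun φ : V → κ => ∀ w ∈ D' p.1, φ w ≠ p.2
  have hcover : (Finset.univ : Finset (V → κ)) ⊆ Finset.univ.biUnion avoiding := fun φ _ => by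
    simpa [avoiding] using hcon φ
  have hunion : Fintype.card κ ^ Fintype.card V ≤ ∑ p, (avoiding p).card := by
    simpa using (Finset.card_le_card hcover).trans Finset.card_biUnion_le
  have hsum : (∑ p, (avoiding p).card) * Fintype.card κ ^ d =
      Fintype.card ι * Fintype.card κ * (Fintype.card κ - 1) ^ d *
        Fintype.card κ ^ Fintype.card V := by
    have hterm (p : ι × κ) := hcard p.1 ▸ card_colouring_avoiding_mul_pow (D' p.1) p.2
    simp only [Finset.sum_mul, avoiding, hterm, Finset.sum_const, Finset.card_univ,
      Fintype.card_prod, smul_eq_mul, mul_assoc]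
  have := Nat.mul_le_mul_right (Fintype.card κ ^ d) hunion
  have := Nat.mul_lt_mul_of_pos_right hd (pow_pos (Fintype.card_pos (α := κ)) (Fintype.card V))
  lia

theorem exists_balanced_colouring (V : Type*) [Fintype V] {m : ℕ} (hm : 0 < m) :
    ∃ g : V → Fin m, ∀ i, {z | g z = i}.ncard ≤ Fintype.card V / m + 1 := by
  let e := Fintype.equivFin V
  refine ⟨fun v => ⟨e v % m, Nat.mod_lt _ hm⟩, fun i => ?_⟩
  rw [← Finset.card_range (Fintype.card V / m + 1), ← Set.ncard_coe_finset]
  refine Set.ncard_le_ncard_of_injOn (fun v => (e v : ℕ) / m) (fun v _ => ?_) ?_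
  · simpa using Nat.lt_succ_of_le (Nat.div_le_div_right (e v).2.le)
  · intro v hv w hw hdiv
    have hdiv : (e v : ℕ) / m = (e w : ℕ) / m := hdiv
    have hmod : (e v : ℕ) % m = (e w : ℕ) % m := congrArg Fin.val (hv.trans hw.symm)
    refine e.injective (Fin.ext ?_)
    rw [← Nat.div_add_mod (e v : ℕ) m, ← Nat.div_add_mod (e w : ℕ) m, hdiv, hmod]

/-! ### Sequences with unit steps -/

/-- Consecutive terms among the first `N` terms of `h` differ by at most one. -/
def HasUnitSteps (N : ℕ) (h : ℕ → ℕ) : Prop :=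
  ∀ i, i + 1 < N → h i ≤ h (i + 1) + 1 ∧ h (i + 1) ≤ h i + 1

namespace HasUnitSteps

variable {N : ℕ} {h : ℕ → ℕ}

theorem le_add (hh : HasUnitSteps N h) {i d : ℕ} (hid : i + d < N) :
    h i ≤ h (i + d) + d ∧ h (i + d) ≤ h i + d := by
  induction d with
  | zero => simp
  | succ d ih =>
    have := ih (by lia)
    have := hh (i + d) (by lia)
    rw [← add_assoc]
    lia

theorem exists_eq (hh : HasUnitSteps N h) {a b D : ℕ} (hab : a ≤ b) (hb : b < N) (ha : D ≤ h a)
    (hD : h b ≤ D) : ∃ i, a ≤ i ∧ i ≤ b ∧ h i = D := by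
  induction b, hab using Nat.le_induction with
  | base => exact ⟨a, le_rfl, le_rfl, le_antisymm hD ha⟩
  | succ b hab ih =>
    by_cases hbD : h b ≤ D
    · obtain ⟨i, hai, hib, hi⟩ := ih (by lia) hbD
      exact ⟨i, hai, by lia, hi⟩
    · have := (hh b hb).1
      exact ⟨b + 1, by lia, le_rfl, by lia⟩

end HasUnitSteps

theorem exists_mem_card_fiber_eq_one {α β : Type*} [DecidableEq β] {s : Finset α} {t u : Finset β}
    {f : α → β} (ht : ∀ b ∈ t, ∃ a ∈ s, f a = b) (hu : u ⊆ t) (hcard : s.card < t.card + u.card) :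
    ∃ b ∈ u, (s.filter fun a => f a = b).card = 1 := by
  by_contra! hcon
  have hone (b) (hb : b ∈ t) : 1 ≤ (s.filter fun a => f a = b).card := by
    obtain ⟨a, ha, hab⟩ := ht b hb
    exact Finset.card_pos.2 ⟨a, Finset.mem_filter.2 ⟨ha, hab⟩⟩
  have hfiber : ∑ b ∈ t, (s.filter fun a => f a = b).card ≤ s.card := by
    rw [Finset.sum_card_fiberwise_eq_card_filter]
    exact Finset.card_filter_le _ _
  have htwo : t.card + u.card ≤ ∑ b ∈ t, (s.filter fun a => f a = b).card := by
    calc t.card + u.card = ∑ b ∈ t, (1 + if b ∈ u then 1 else 0) := by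
          rw [Finset.sum_add_distrib, Finset.sum_ite_mem, Finset.inter_eq_right.2 hu]
          simp
      _ ≤ _ := Finset.sum_le_sum fun b hb => by
          have := hone b hb
          split_ifs with hbu
          · have := hcon b hbu
            lia
          · lia
  lia

theorem HasUnitSteps.exists_unique_level {N a b lo hi s : ℕ} {h : ℕ → ℕ} (hh : HasUnitSteps N h)
    (hab : a < b) (hb : b < N) (hsa : s < h a) (hhb : h b = 0) (hlo : 1 ≤ lo) (hhi : hi ≤ s)
    (hroom : b + lo < a + s + hi + 2) :
    ∃ y < b, lo ≤ h y ∧ h y ≤ hi ∧ (∀ i, a ≤ i → i < y → h y < h i) ∧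
      ∀ j, y < j → j ≤ b → h j < h y := by
  have hmeet : ∀ D ∈ Finset.Icc 1 s, ∃ i ∈ Finset.Ioo a b, h i = D := fun D hD => by
    rw [Finset.mem_Icc] at hD
    obtain ⟨i, hai, hib, rfl⟩ := hh.exists_eq hab.le hb (hD.2.trans hsa.le) (by lia)
    have : i ≠ a := by rintro rfl; lia
    have : i ≠ b := by rintro rfl; lia
    exact ⟨i, Finset.mem_Ioo.2 ⟨by lia, by lia⟩, rfl⟩
  obtain ⟨D, hD, hcard⟩ := exists_mem_card_fiber_eq_one hmeet (u := Finset.Icc lo hi)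
    (Finset.Icc_subset_Icc hlo hhi) (by simp only [Nat.card_Ioo, Nat.card_Icc]; lia)
  rw [Finset.mem_Icc] at hD
  obtain ⟨y, hy⟩ := Finset.card_eq_one.1 hcard
  obtain ⟨hyM, rfl⟩ := Finset.mem_filter.1 (hy.ge (Finset.mem_singleton_self y))
  rw [Finset.mem_Ioo] at hyM
  have hunique (i) (hai : a ≤ i) (hib : i ≤ b) (hi : h i = h y) : i = y := by
    have : i ≠ a := by rintro rfl; lia
    have : i ≠ b := by rintro rfl; lia
    exact Finset.mem_singleton.1
      (hy.le (Finset.mem_filter.2 ⟨Finset.mem_Ioo.2 ⟨by lia, by lia⟩, hi⟩))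
  refine ⟨y, hyM.2, hD.1, hD.2, fun i hai hiy => ?_, fun j hyj hjb => ?_⟩
  · by_contra! hle
    obtain ⟨i', hai', hii', hi'⟩ := hh.exists_eq (D := h y) hai (by lia) (by lia) hle
    exact absurd (hunique i' hai' (by lia) hi') (by lia)
  · by_contra! hle
    obtain ⟨j', hjj', hjb', hj'⟩ := hh.exists_eq (D := h y) hjb hb hle (by lia)
    exact absurd (hunique j' (by lia) hjb' hj') (by lia)

/-- A path of order `4r + 3` starts far from a set, at two places, and ends in it, at two places.
There are too few vertices between `a₂` and `b₁` to meet twice each level of the window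
`[4r + 2 - b₁, 2r + 1 - a₂]`, which lies below the levels up to `a₂` and above those from `b₁`. -/
theorem HasUnitSteps.exists_unique_crossing {r a₁ a₂ b₁ b₂ : ℕ} {h : ℕ → ℕ}
    (hh : HasUnitSteps (4 * r + 3) h) (ha : a₁ < a₂) (hab : a₂ < b₁) (hb : b₁ < b₂)
    (hN : b₂ < 4 * r + 3) (ha₁ : 2 * r + 1 ≤ h a₁) (ha₂ : 2 * r + 1 ≤ h a₂) (hb₁ : h b₁ = 0)
    (hb₂ : h b₂ = 0) :
    ∃ y, y < b₁ ∧ h y ≤ 2 * r ∧ (∀ i < y, h y < h i) ∧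
      ∀ j < 4 * r + 3, y < j → h j < h y := by
  have hdist {i j : ℕ} (hij : i ≤ j) (hj : j < 4 * r + 3) :
      h i ≤ h j + (j - i) ∧ h j ≤ h i + (j - i) := by
    simpa [Nat.add_sub_cancel' hij] using hh.le_add (i := i) (d := j - i) (by lia)
  have hbefore (i) (hi : i ≤ a₂) : 2 * r + 2 ≤ h i + a₂ := by
    have := hdist hi (by lia)
    rcases le_total a₁ i with hai | hia
    · have := hdist hai (by lia)
      lia
    · have := hdist hia (by lia)
      lia
  have hafter (j) (hbj : b₁ ≤ j) (hj : j < 4 * r + 3) : h j + b₁ ≤ 4 * r + 1 := by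
    have := hdist hbj hj
    rcases le_total b₂ j with hbj | hjb
    · have := hdist hbj hj
      lia
    · have := hdist hjb hN
      lia
  have := hdist hab.le (by lia)
  obtain ⟨y, hyb, hlo, hhi, hlt, hgt⟩ := hh.exists_unique_level (s := 2 * r)
    (lo := 4 * r + 2 - b₁) (hi := 2 * r + 1 - a₂) hab (by lia) (by lia) hb₁ (by lia) (by lia)
    (by lia)
  refine ⟨y, hyb, by lia, fun i hi => ?_, fun j hj hyj => ?_⟩
  · rcases le_total a₂ i with hai | hia
    · exact hlt i hai hi
    · have := hbefore i hia
      lia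
  · rcases le_total j b₁ with hjb | hbj
    · exact hgt j hyj hjb
    · have := hafter j hbj hj
      lia

/-! ### Induced paths as sequences -/

/-- The first `t` terms of the sequence `x` are distinct and `K` relates two of them, in the order
of the sequence, exactly when they are consecutive: an induced path on `t` vertices. Later terms
are irrelevant. -/
def IsInducedPath {α : Type*} (K : α → α → Prop) (t : ℕ) (x : ℕ → α) : Prop :=
  ∀ i j, i < j → j < t → x i ≠ x j ∧ (K (x i) (x j) ↔ j = i + 1)

namespace IsInducedPath

variable {α β : Type*} {K : α → α → Prop} {K' : β → β → Prop} {s t : ℕ} {x y : ℕ → α}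

theorem mono (hx : IsInducedPath K t x) (hst : s ≤ t) : IsInducedPath K s x :=
  fun i j hij hj => hx i j hij (hj.trans_le hst)

theorem shift (hx : IsInducedPath K (s + t) x) : IsInducedPath K t fun i => x (s + i) := by
  intro i j hij hj
  have h := hx (s + i) (s + j) (by lia) (by lia)
  exact ⟨h.1, h.2.trans (by lia)⟩

theorem rel_succ (hx : IsInducedPath K t x) {i : ℕ} (hi : i + 1 < t) : K (x i) (x (i + 1)) :=
  (hx i (i + 1) i.lt_succ_self hi).2.2 rfl

theorem le_card [Fintype α] (hx : IsInducedPath K t x) : t ≤ Fintype.card α := by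
  have hinj : Function.Injective fun i : Fin t => x i := fun i j hij => by
    by_contra hne
    rcases lt_or_gt_of_ne hne with hlt | hlt
    · exact (hx i j hlt j.2).1 hij
    · exact (hx j i hlt i.2).1 hij.symm
  simpa using Fintype.card_le_of_injective _ hinj

theorem iff_of_injective {f : α → β} (hf : Function.Injective f) {z : ℕ → β}
    (hz : ∀ i < t, z i = f (x i))
    (hK : ∀ i j, i < j → j < t → (K' (f (x i)) (f (x j)) ↔ K (x i) (x j))) :
    IsInducedPath K' t z ↔ IsInducedPath K t x := by
  refine forall_congr' fun i => forall_congr' fun j => forall_congr' fun hij =>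
    forall_congr' fun hj => ?_
  rw [hz i (hij.trans hj), hz j hj, hf.ne_iff, hK i j hij hj]

/-- The level `f (x t) = f (y 0)` separates the two paths, so no edge joins them elsewhere. -/
theorem append {f : α → ℕ} (hf : ∀ a b, K a b → f a ≤ f b + 1) (hx : IsInducedPath K (t + 1) x)
    (hy : IsInducedPath K s y) (hxy : x t = y 0) (hxf : ∀ i < t, f (x t) < f (x i))
    (hyf : ∀ i, 0 < i → i < s → f (y i) < f (y 0)) :
    IsInducedPath K (t + s) fun i => if i < t then x i else y (i - t) := by
  intro i j hij hj
  by_cases hi : i < t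
  · by_cases hjt : j < t
    · simpa only [hi, hjt, if_true] using hx i j hij (by lia)
    · simp only [hi, hjt, if_true, if_false]
      rcases (not_lt.1 hjt).eq_or_lt with rfl | hjt
      · rw [Nat.sub_self, ← hxy]
        exact hx i t hij (by lia)
      · have hxi := hxf i hi
        have hyj := hyf (j - t) (by lia) (by lia)
        rw [hxy] at hxi
        refine ⟨fun h => by rw [h] at hxi; lia, fun h => ?_, fun h => by lia⟩
        have := hf _ _ h
        lia
  · have hjt : ¬ j < t := by lia
    simp only [hi, hjt, if_false]
    have h := hy (i - t) (j - t) (by lia) (by lia)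
    exact ⟨h.1, h.2.trans (by lia)⟩

end IsInducedPath

theorem isIndContained_pathGraph_iff {V : Type*} {G : SimpleGraph V} {t : ℕ} (ht : 0 < t) :
    (SimpleGraph.pathGraph t).IsIndContained G ↔ ∃ x : ℕ → V, IsInducedPath G.Adj t x := by
  constructor
  · rintro ⟨f⟩
    refine ⟨fun i => if h : i < t then f ⟨i, h⟩ else f ⟨0, ht⟩, fun i j hij hj => ?_⟩
    simp only [hij.trans hj, hj, dif_pos]
    rw [f.map_adj_iff, SimpleGraph.pathGraph_adj, ne_eq, f.injective.eq_iff, Fin.mk.injEq]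
    lia
  · rintro ⟨x, hx⟩
    refine ⟨⟨⟨fun i => x i, fun i j hij => ?_⟩, fun {i j} => ?_⟩⟩
    · by_contra hne
      rcases lt_or_gt_of_ne hne with hlt | hlt
      · exact (hx i j hlt j.2).1 hij
      · exact (hx j i hlt i.2).1 hij.symm
    · change G.Adj (x i) (x j) ↔ _
      rw [SimpleGraph.pathGraph_adj]
      rcases lt_trichotomy i j with hlt | rfl | hlt
      · rw [(hx i j hlt j.2).2]
        lia
      · simp
      · rw [G.adj_comm, (hx j i hlt i.2).2]
        lia

theorem not_isInducedPathFree_iff {V : Type} {G : SimpleGraph V} {m : ℕ} (hm : 0 < m) :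
    ¬ IsInducedPathFree m V G ↔ ∃ x : ℕ → V, IsInducedPath G.Adj m x := by
  rw [IsInducedPathFree, not_not, isIndContained_pathGraph_iff hm]

/-! ### The verifier -/

/-- The entries of a cluster map; `a`, `b` are identifiers of vertices and a cluster is named by
the identifier `B` of its root.
* `label a l`: the vertex `a` belongs to the cluster `l`, or to no cluster if `l = 0`;
* `depth a d`: its depth in the spanning tree of its cluster;
* `mid a x`: the vertex `x` compares the rows read by `a` and by its parent in the tree;
* `far B a d`: its distance to the cluster `B`;
* `reach B a t`: the order of a longest induced path which starts at `a` and then stays closer to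
  `B` than `a`;
* `lowAdj a b`: the vertex `a`, which belongs to no cluster, is adjacent to `b`. -/
inductive MapEntry
  | label (a l : ℕ)
  | depth (a d : ℕ)
  | mid (a x : ℕ)
  | far (B a d : ℕ)
  | reach (B a t : ℕ)
  | lowAdj (a b : ℕ)

/-- The part of the certificates which is the same at all vertices. Missing entries are read as
the infimum of the empty set, that is `0`. -/
abbrev ClusterMap : Type := Finset MapEntry

namespace ClusterMap

/-- The vertex `a` appears in the map. -/
def IsVertex (C : ClusterMap) (a : ℕ) : Prop := ∃ l, MapEntry.label a l ∈ C

/-- The cluster of `a`, and `0` if `a` is in no cluster. -/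
noncomputable def label (C : ClusterMap) (a : ℕ) : ℕ := sInf {l | MapEntry.label a l ∈ C}

/-- The depth of `a` in the spanning tree of its cluster. -/
noncomputable def depth (C : ClusterMap) (a : ℕ) : ℕ := sInf {d | MapEntry.depth a d ∈ C}

/-- The vertex which compares the rows read by `a` and by its parent. -/
noncomputable def mid (C : ClusterMap) (a : ℕ) : ℕ := sInf {x | MapEntry.mid a x ∈ C}

/-- The distance of `a` to the cluster `B`, truncated at `2 * r + 1`, the least distance between
two clusters. -/
noncomputable def far (r : ℕ) (C : ClusterMap) (B a : ℕ) : ℕ :=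
  sInf (insert (2 * r + 1) {d | MapEntry.far B a d ∈ C})

/-- The order of a longest induced path from `a` that then stays closer to `B`. -/
noncomputable def reach (C : ClusterMap) (B a : ℕ) : ℕ := sInf {t | MapEntry.reach B a t ∈ C}

theorem label_eq_zero_of_not_isVertex {C : ClusterMap} {a : ℕ} (h : ¬ C.IsVertex a) :
    C.label a = 0 := by
  rw [IsVertex, not_exists] at h
  simp [label, h]

end ClusterMap

/-- The content of a certificate: the common map, and some of the rows of the adjacency matrix,
as pairs of identifiers of adjacent vertices. -/
structure Certificate where
  map : ClusterMap
  rows : Finset (ℕ × ℕ)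

namespace Certificate

/-- The listed neighbours of `z`; empty when the certificate does not hold the row of `z`. -/
def row (F : Certificate) (z : ℕ) : Set ℕ := {b | (z, b) ∈ F.rows}

/-- The entries of a certificate, as a tag and three arguments. -/
def entry : MapEntry ⊕ ℕ × ℕ → (ℕ × ℕ) × ℕ × ℕ
  | .inl (.label a l) => ((0, a), l, 0)
  | .inl (.depth a d) => ((1, a), d, 0)
  | .inl (.mid a x) => ((2, a), x, 0)
  | .inl (.far B a d) => ((3, a), d, B)
  | .inl (.reach B a t) => ((4, a), t, B)
  | .inl (.lowAdj a b) => ((5, a), b, 0)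
  | .inr e => ((6, e.1), e.2, 0)

theorem entry_injective : Function.Injective entry := by
  rintro ((_ | _ | _ | _ | _ | _) | _) ((_ | _ | _ | _ | _ | _) | _) h <;>
    simp_all [entry, Prod.ext_iff]

/-- The numbering of the entries of a certificate. -/
def entryEmbedding : MapEntry ⊕ ℕ × ℕ ↪ ℕ where
  toFun e := Nat.pair (Nat.pair (entry e).1.1 (entry e).1.2)
    (Nat.pair (entry e).2.1 (entry e).2.2)
  inj' e e' h := entry_injective <| by
    simp only [Nat.pair_eq_pair] at h
    ext
    exacts [h.1.1, h.1.2, h.2.1, h.2.2]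

/-- The bit string of a certificate. -/
noncomputable def encode (F : Certificate) : List Bool :=
  encodeFinset entryEmbedding (F.map.disjSum F.rows)

theorem encode_injective : Function.Injective encode := by
  rintro ⟨C, R⟩ ⟨C', R'⟩ h
  have := encodeFinset_injective _ h
  simp_all [Finset.disjSum_inj]

end Certificate

namespace LocalView

/-- The view `W` shows a neighbour of `u` whose certificate holds the row `S` of `z`. -/
def ReadsRow (W : LocalView) (u z : ℕ) (S : Set ℕ) : Prop :=
  ∃ w F, (u, w) ∈ W.edges ∧ (w, Certificate.encode F) ∈ W.labels ∧ F.row z = S ∧ S.Nonempty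

/-- The adjacencies that the centre of the view knows: from the map those which involve a vertex
outside all clusters, and from the rows it reads those inside its own cluster. -/
def KnownAdj (W : LocalView) (C : ClusterMap) (a b : ℕ) : Prop :=
  C.label a = 0 ∧ MapEntry.lowAdj a b ∈ C ∨
    C.label a ≠ 0 ∧ C.label b = 0 ∧ MapEntry.lowAdj b a ∈ C ∨
    C.label a ≠ 0 ∧ C.label a = C.label b ∧ ∃ S, W.ReadsRow W.center a S ∧ b ∈ S

/-- The vertices about which the centre of the view knows all adjacencies. -/
def IsKnown (W : LocalView) (C : ClusterMap) (a : ℕ) : Prop :=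
  C.IsVertex a ∧ (C.label a = 0 ∨ C.label a = C.label W.center)

/-- What a vertex that belongs to a cluster checks. -/
structure ClusterAccepts (r : ℕ) (W : LocalView) (C : ClusterMap) : Prop where
  far_own : C.far r (C.label W.center) W.center = 0
  far_other : ∀ B, B ≠ C.label W.center → 2 * r + 1 ≤ C.far r B W.center
  readsRow_self : W.ReadsRow W.center W.center {b | (W.center, b) ∈ W.edges}
  readsRow_unique : ∀ z, C.label z = C.label W.center → ∀ S S', W.ReadsRow W.center z S →
    W.ReadsRow W.center z S' → S = S'
  root_or_mid : W.center = C.label W.center ∨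
    ∃ F, (C.mid W.center, Certificate.encode F) ∈ W.labels
  le_reach : ∀ (x : ℕ → ℕ) (t : ℕ), (∀ i < t + 1, W.IsKnown C (x i)) →
    IsInducedPath (W.KnownAdj C) (t + 1) x →
    (∀ i, 0 < i → i < t + 1 →
      C.far r (C.label W.center) (x i) < C.far r (C.label W.center) (x 0)) →
    t + 1 ≤ C.reach (C.label W.center) (x 0)
  add_reach_lt : ∀ B, B ≠ C.label W.center → ∀ (x : ℕ → ℕ) (t : ℕ),
    (∀ i < t + 1, W.IsKnown C (x i)) → IsInducedPath (W.KnownAdj C) (t + 1) x →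
    (∀ i < t, C.far r B (x t) < C.far r B (x i)) → t + C.reach B (x t) < 4 * r + 3

/-- What the centre of the view `W` checks about the map `C`. -/
structure Accepts (r : ℕ) (W : LocalView) (C : ClusterMap) : Prop where
  map_eq : ∀ w F, (W.center, w) ∈ W.edges → (w, Certificate.encode F) ∈ W.labels → F.map = C
  isVertex : C.IsVertex W.center
  lowAdj_iff : C.label W.center = 0 → ∀ b, MapEntry.lowAdj W.center b ∈ C ↔ (W.center, b) ∈ W.edges
  far_le : ∀ B w, (W.center, w) ∈ W.edges → C.far r B W.center ≤ C.far r B w + 1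
  parent_of_mid : ∀ u, C.mid u = W.center → ∃ p, C.label p = C.label u ∧ C.depth p < C.depth u ∧
    ∀ z, C.label z = C.label u → ∃ S, W.ReadsRow u z S ∧ W.ReadsRow p z S
  free : ∀ x : ℕ → ℕ, (∀ i < 4 * r + 3, C.IsVertex (x i)) →
    IsInducedPath (W.KnownAdj C) (4 * r + 3) x →
    ∃ i j, i < j ∧ j < 4 * r + 3 ∧ C.label (x i) = C.label (x j) ∧ C.label (x i) ≠ 0 ∧
      C.label (x i) ≠ C.label W.center
  cluster : C.label W.center ≠ 0 → W.ClusterAccepts r C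

/-- The verification algorithm at radius `r + 1`. -/
def Verifies (r : ℕ) (W : LocalView) : Prop :=
  ∃ F, (W.center, Certificate.encode F) ∈ W.labels ∧ W.Accepts r F.map

/-- The map `C` and the rows read by the centre of the view `W` describe `G` truthfully on the set
`R` of vertices. -/
structure IsFaithful {V : Type} (G : SimpleGraph V) (ident : V → ℕ) (R : Set V) (W : LocalView)
    (C : ClusterMap) : Prop where
  lowAdj_iff : ∀ u ∈ R, C.label (ident u) = 0 → ∀ v,
    MapEntry.lowAdj (ident u) (ident v) ∈ C ↔ G.Adj u v
  not_adj : ∀ u ∈ R, ∀ v ∈ R, C.label (ident u) ≠ 0 → C.label (ident v) ≠ 0 →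
    C.label (ident u) ≠ C.label (ident v) → ¬ G.Adj u v
  readsRow_iff : ∀ u ∈ R, C.label (ident u) ≠ 0 → C.label (ident u) = C.label W.center →
    ∀ S, W.ReadsRow W.center (ident u) S ↔ S = ident '' G.neighborSet u

theorem IsFaithful.knownAdj_iff {V : Type} {G : SimpleGraph V} {ident : V → ℕ} {R : Set V}
    {W : LocalView} {C : ClusterMap} (hW : W.IsFaithful G ident R C)
    (hident : Function.Injective ident) {u v : V} (hu : u ∈ R) (hv : v ∈ R)
    (huv : C.label (ident u) = C.label (ident v) →
      C.label (ident u) = 0 ∨ C.label (ident u) = C.label W.center) :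
    W.KnownAdj C (ident u) (ident v) ↔ G.Adj u v := by
  unfold KnownAdj
  by_cases hu₀ : C.label (ident u) = 0
  · simp [hu₀, hW.lowAdj_iff u hu hu₀]
  by_cases hv₀ : C.label (ident v) = 0
  · simp [hu₀, hv₀, hW.lowAdj_iff v hv hv₀, G.adj_comm]
  by_cases hlabel : C.label (ident u) = C.label (ident v)
  · simp [hlabel, hv₀, hW.readsRow_iff u hu hu₀ ((huv hlabel).resolve_left hu₀),
      hident.mem_set_image]
  · simp [hu₀, hv₀, hlabel, hW.not_adj u hu v hv hu₀ hv₀ hlabel]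

theorem IsFaithful.isInducedPath_iff {V : Type} {G : SimpleGraph V} {ident : V → ℕ} {R : Set V}
    {W : LocalView} {C : ClusterMap} (hW : W.IsFaithful G ident R C)
    (hident : Function.Injective ident) {t : ℕ} {x : ℕ → V} {z : ℕ → ℕ}
    (hz : ∀ i < t, z i = ident (x i)) (hx : ∀ i < t, x i ∈ R)
    (hlabel : ∀ i j, i < j → j < t → C.label (ident (x i)) = C.label (ident (x j)) →
      C.label (ident (x i)) = 0 ∨ C.label (ident (x i)) = C.label W.center) :
    IsInducedPath (W.KnownAdj C) t z ↔ IsInducedPath G.Adj t x :=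
  IsInducedPath.iff_of_injective hident hz fun i j hij hj =>
    hW.knownAdj_iff hident (hx i (hij.trans hj)) (hx j hj) (hlabel i j hij hj)

end LocalView

/-! ### Soundness -/

section View

variable {V : Type} {G : SimpleGraph V} {ident : V → ℕ} {cert : V → List Bool} {d : ℕ} {v w : V}

theorem reachable_of_edist_le (h : G.edist v w ≤ d) : G.Reachable v w :=
  SimpleGraph.edist_ne_top_iff_reachable.1 (ne_top_of_le_ne_top (ENat.natCast_ne_top d) h)

theorem mk_mem_labels (h : G.edist v w ≤ d) :
    (ident w, cert w) ∈ (localView G ident cert d v).labels :=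
  ⟨w, h, rfl⟩

theorem exists_of_mem_labels {a : ℕ} {l : List Bool}
    (h : (a, l) ∈ (localView G ident cert d v).labels) :
    ∃ w, G.Reachable v w ∧ ident w = a ∧ cert w = l := by
  obtain ⟨w, hw, h⟩ := h
  obtain ⟨rfl, rfl⟩ := Prod.mk.inj h
  exact ⟨w, reachable_of_edist_le hw, rfl, rfl⟩

theorem exists_of_mem_edges {a b : ℕ} (h : (a, b) ∈ (localView G ident cert d v).edges) :
    ∃ u w, G.Reachable v u ∧ G.Adj u w ∧ ident u = a ∧ ident w = b := by
  obtain ⟨u, w, huw, hu, -, -, h⟩ := h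
  obtain ⟨rfl, rfl⟩ := Prod.mk.inj h
  exact ⟨u, w, reachable_of_edist_le hu, huw, rfl, rfl⟩

theorem edist_le_add_one {u : V} (hu : G.edist v u ≤ d) (huw : G.Adj u w) :
    G.edist v w ≤ (d + 1 : ℕ) := by
  refine (SimpleGraph.edist_triangle (v := u)).trans ?_
  rw [SimpleGraph.edist_eq_one_iff_adj.2 huw]
  push_cast
  gcongr

theorem mk_mem_edges {u : V} (hu : G.edist v u ≤ d) (huw : G.Adj u w) :
    (ident u, ident w) ∈ (localView G ident cert (d + 1) v).edges := by
  have hlt : (d : ℕ∞) < (d + 1 : ℕ) := Nat.cast_lt.2 d.lt_succ_self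
  exact ⟨u, w, huw, hu.trans hlt.le, edist_le_add_one hu huw, fun h => (hu.trans_lt hlt).ne h.1,
    rfl⟩

theorem center_mem_edges_iff (hident : Function.Injective ident) {b : ℕ} :
    (ident v, b) ∈ (localView G ident cert (d + 1) v).edges ↔ b ∈ ident '' G.neighborSet v := by
  constructor
  · intro h
    obtain ⟨u, w, -, huw, hu, rfl⟩ := exists_of_mem_edges h
    exact ⟨w, hident hu ▸ huw, rfl⟩
  · rintro ⟨w, hw, rfl⟩
    exact mk_mem_edges (by simp) hw

end View

section Soundness

variable {V : Type} {G : SimpleGraph V} {ident : V → ℕ} {F : V → Certificate} {r : ℕ}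

/-- The view at distance `r + 1` when the vertices carry the certificates `F`. -/
noncomputable abbrev certificateView (G : SimpleGraph V) (ident : V → ℕ) (F : V → Certificate)
    (r : ℕ) (v : V) : LocalView :=
  localView G ident (Certificate.encode ∘ F) (r + 1) v

/-- Some neighbour of `u` holds the row `S` of the vertex with identifier `z`. -/
def Reads (G : SimpleGraph V) (F : V → Certificate) (u : V) (z : ℕ) (S : Set ℕ) : Prop :=
  ∃ w, G.Adj u w ∧ (F w).row z = S ∧ S.Nonempty

theorem exists_of_mem_labels_encode {v : V} {a : ℕ} {F' : Certificate}
    (h : (a, F'.encode) ∈ (certificateView G ident F r v).labels) :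
    ∃ w, G.Reachable v w ∧ ident w = a ∧ F w = F' := by
  obtain ⟨w, hw, hwa, hwF⟩ := exists_of_mem_labels h
  exact ⟨w, hw, hwa, Certificate.encode_injective hwF⟩

theorem exists_reads_of_readsRow (hident : Function.Injective ident) {v : V} {a z : ℕ} {S : Set ℕ}
    (h : (certificateView G ident F r v).ReadsRow a z S) :
    ∃ u, G.Reachable v u ∧ ident u = a ∧ Reads G F u z S := by
  obtain ⟨b, F', hedge, hlabel, hS⟩ := h
  obtain ⟨u, w, hvu, huw, hu, rfl⟩ := exists_of_mem_edges hedge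
  obtain ⟨w', -, hw', rfl⟩ := exists_of_mem_labels_encode hlabel
  obtain rfl := hident hw'
  exact ⟨u, hvu, hu, w', huw, hS⟩

theorem readsRow_iff (hident : Function.Injective ident) {u v : V} (huv : G.edist v u ≤ r) {z : ℕ}
    {S : Set ℕ} :
    (certificateView G ident F r v).ReadsRow (ident u) z S ↔ Reads G F u z S := by
  constructor
  · intro h
    obtain ⟨u', -, hu', h⟩ := exists_reads_of_readsRow hident h
    exact hident hu' ▸ h
  · rintro ⟨w, huw, hS⟩
    exact ⟨ident w, F w, mk_mem_edges huv huw, mk_mem_labels (edist_le_add_one huv huw), hS⟩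

theorem center_readsRow_iff (hident : Function.Injective ident) {v : V} {z : ℕ} {S : Set ℕ} :
    (certificateView G ident F r v).ReadsRow (ident v) z S ↔ Reads G F v z S :=
  readsRow_iff hident (by simp)

/-- A union of components of the network in which all vertices accept the map `C`. -/
structure IsAcceptedRegion (G : SimpleGraph V) (ident : V → ℕ) (F : V → Certificate) (r : ℕ)
    (C : ClusterMap) (R : Set V) : Prop where
  pos : 0 < r
  injective : Function.Injective ident
  mem_of_reachable : ∀ u ∈ R, ∀ v, G.Reachable u v → v ∈ R
  accepts : ∀ v ∈ R, (certificateView G ident F r v).Accepts r C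

namespace IsAcceptedRegion

variable {C : ClusterMap} {R : Set V} {u v : V}

theorem clusterAccepts (hR : IsAcceptedRegion G ident F r C R) (hv : v ∈ R)
    (hv₀ : C.label (ident v) ≠ 0) : (certificateView G ident F r v).ClusterAccepts r C :=
  (hR.accepts v hv).cluster hv₀

theorem far_own (hR : IsAcceptedRegion G ident F r C R) (hv : v ∈ R)
    (hv₀ : C.label (ident v) ≠ 0) : C.far r (C.label (ident v)) (ident v) = 0 :=
  (hR.clusterAccepts hv hv₀).far_own

theorem le_far (hR : IsAcceptedRegion G ident F r C R) (hv : v ∈ R)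
    (hv₀ : C.label (ident v) ≠ 0) {B : ℕ} (hB : B ≠ C.label (ident v)) :
    2 * r + 1 ≤ C.far r B (ident v) :=
  (hR.clusterAccepts hv hv₀).far_other B hB

theorem reads_unique (hR : IsAcceptedRegion G ident F r C R) (hu : u ∈ R)
    (hu₀ : C.label (ident u) ≠ 0) {z : ℕ} (hz : C.label z = C.label (ident u)) {S S' : Set ℕ}
    (hS : Reads G F u z S) (hS' : Reads G F u z S') : S = S' :=
  (hR.clusterAccepts hu hu₀).readsRow_unique z hz S S'
    ((center_readsRow_iff hR.injective).2 hS) ((center_readsRow_iff hR.injective).2 hS')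

theorem reads_self (hR : IsAcceptedRegion G ident F r C R) (hv : v ∈ R)
    (hv₀ : C.label (ident v) ≠ 0) : Reads G F v (ident v) (ident '' G.neighborSet v) := by
  have hrow := (hR.clusterAccepts hv hv₀).readsRow_self
  have hedges : {b | (ident v, b) ∈ (certificateView G ident F r v).edges} =
      ident '' G.neighborSet v := by
    ext b
    exact center_mem_edges_iff (cert := Certificate.encode ∘ F) hR.injective
  exact hedges ▸ (center_readsRow_iff hR.injective).1 hrow

theorem exists_parent (hR : IsAcceptedRegion G ident F r C R) (hu : u ∈ R)
    (hu₀ : C.label (ident u) ≠ 0) (hroot : ident u ≠ C.label (ident u)) :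
    ∃ p ∈ R, C.label (ident p) = C.label (ident u) ∧ C.depth (ident p) < C.depth (ident u) ∧
      ∀ z, C.label z = C.label (ident u) → ∀ S, Reads G F u z S ↔ Reads G F p z S := by
  obtain ⟨F', hF'⟩ := (hR.clusterAccepts hu hu₀).root_or_mid.resolve_left hroot
  obtain ⟨x, hux, hx, -⟩ := exists_of_mem_labels_encode hF'
  have hxR := hR.mem_of_reachable u hu x hux
  obtain ⟨a, hlabel, hdepth, hrows⟩ := (hR.accepts x hxR).parent_of_mid (ident u) hx.symm
  obtain ⟨_, -, hread⟩ := hrows (ident u) rfl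
  obtain ⟨p, hxp, rfl, -⟩ := exists_reads_of_readsRow hR.injective hread
  have hpR := hR.mem_of_reachable x hxR p hxp
  refine ⟨p, hpR, hlabel, hdepth, fun z hz T => ?_⟩
  obtain ⟨S, huS, hpS⟩ := hrows z hz
  obtain ⟨u', -, hu', huS'⟩ := exists_reads_of_readsRow hR.injective huS
  obtain rfl := hR.injective hu'
  obtain ⟨p', -, hp', hpS'⟩ := exists_reads_of_readsRow hR.injective hpS
  obtain rfl := hR.injective hp'
  constructor
  · intro hT
    exact hR.reads_unique hu hu₀ hz hT huS' ▸ hpS'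
  · intro hT
    exact hR.reads_unique hpR (hlabel ▸ hu₀) (hz.trans hlabel.symm) hT hpS' ▸ huS'

theorem exists_root (hR : IsAcceptedRegion G ident F r C R) (hu : u ∈ R)
    (hu₀ : C.label (ident u) ≠ 0) :
    ∃ s, ident s = C.label (ident u) ∧
      ∀ z, C.label z = C.label (ident u) → ∀ S, Reads G F u z S ↔ Reads G F s z S := by
  induction hd : C.depth (ident u) using Nat.strong_induction_on generalizing u with
  | _ d ih =>
  by_cases hroot : ident u = C.label (ident u)
  · exact ⟨u, hroot, fun _ _ _ => Iff.rfl⟩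
  · obtain ⟨p, hp, hlabel, hdepth, hup⟩ := hR.exists_parent hu hu₀ hroot
    obtain ⟨s, hs, hps⟩ := ih _ (hd ▸ hdepth) hp (hlabel ▸ hu₀) rfl
    rw [hlabel] at hs hps
    exact ⟨s, hs, fun z hz S => (hup z hz S).trans (hps z hz S)⟩

theorem reads_iff (hR : IsAcceptedRegion G ident F r C R) (hu : u ∈ R) (hv : v ∈ R)
    (hv₀ : C.label (ident v) ≠ 0) (hvu : C.label (ident v) = C.label (ident u)) {S : Set ℕ} :
    Reads G F u (ident v) S ↔ S = ident '' G.neighborSet v := by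
  obtain ⟨s, hs, hus⟩ := hR.exists_root hu (hvu ▸ hv₀)
  obtain ⟨s', hs', hvs⟩ := hR.exists_root hv hv₀
  obtain rfl : s' = s := hR.injective (by rw [hs, hs', hvu])
  rw [hus _ hvu, ← hvs _ rfl]
  constructor
  · exact fun h => hR.reads_unique hv hv₀ rfl h (hR.reads_self hv hv₀)
  · rintro rfl
    exact hR.reads_self hv hv₀

theorem far_le (hR : IsAcceptedRegion G ident F r C R) (hu : u ∈ R) (huv : G.Adj u v) (B : ℕ) :
    C.far r B (ident u) ≤ C.far r B (ident v) + 1 :=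
  (hR.accepts u hu).far_le B _ ((center_mem_edges_iff hR.injective).2 ⟨v, huv, rfl⟩)

theorem isFaithful (hR : IsAcceptedRegion G ident F r C R) (hv : v ∈ R) :
    (certificateView G ident F r v).IsFaithful G ident R C where
  lowAdj_iff u hu hu₀ w := by
    refine ((hR.accepts u hu).lowAdj_iff hu₀ _).trans ?_
    exact (center_mem_edges_iff hR.injective).trans hR.injective.mem_set_image
  not_adj u hu w hw hu₀ hw₀ huw hadj := by
    have hfar := hR.far_le hu hadj (C.label (ident w))
    have hother := hR.le_far hu hu₀ huw.symm
    have hown := hR.far_own hw hw₀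
    have hpos := hR.pos
    lia
  readsRow_iff u hu hu₀ huv S :=
    (center_readsRow_iff hR.injective).trans (hR.reads_iff hv hu hu₀ huv)

section Path

variable {t : ℕ} {x : ℕ → V}

theorem le_reach (hR : IsAcceptedRegion G ident F r C R) (hv : v ∈ R)
    (hv₀ : C.label (ident v) ≠ 0) (hxR : ∀ i < t + 1, x i ∈ R)
    (hlabel : ∀ i < t + 1, C.label (ident (x i)) = 0 ∨
      C.label (ident (x i)) = C.label (ident v))
    (hx : IsInducedPath G.Adj (t + 1) x)
    (hfar : ∀ i, 0 < i → i < t + 1 → C.far r (C.label (ident v)) (ident (x i)) <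
      C.far r (C.label (ident v)) (ident (x 0))) :
    t + 1 ≤ C.reach (C.label (ident v)) (ident (x 0)) :=
  (hR.clusterAccepts hv hv₀).le_reach (fun i => ident (x i)) t
    (fun i hi => ⟨(hR.accepts _ (hxR i hi)).isVertex, hlabel i hi⟩)
    (((hR.isFaithful hv).isInducedPath_iff hR.injective (fun _ _ => rfl) hxR
      fun i _ hij hj _ => hlabel i (hij.trans hj)).2 hx) hfar

theorem add_reach_lt (hR : IsAcceptedRegion G ident F r C R) (hv : v ∈ R)
    (hv₀ : C.label (ident v) ≠ 0) {B : ℕ} (hB : B ≠ C.label (ident v))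
    (hxR : ∀ i < t + 1, x i ∈ R)
    (hlabel : ∀ i < t + 1, C.label (ident (x i)) = 0 ∨
      C.label (ident (x i)) = C.label (ident v))
    (hx : IsInducedPath G.Adj (t + 1) x)
    (hfar : ∀ i < t, C.far r B (ident (x t)) < C.far r B (ident (x i))) :
    t + C.reach B (ident (x t)) < 4 * r + 3 :=
  (hR.clusterAccepts hv hv₀).add_reach_lt B hB (fun i => ident (x i)) t
    (fun i hi => ⟨(hR.accepts _ (hxR i hi)).isVertex, hlabel i hi⟩)
    (((hR.isFaithful hv).isInducedPath_iff hR.injective (fun _ _ => rfl) hxR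
      fun i _ hij hj _ => hlabel i (hij.trans hj)).2 hx) hfar

theorem hasUnitSteps_far (hR : IsAcceptedRegion G ident F r C R)
    (hxR : ∀ i < t, x i ∈ R) (hx : IsInducedPath G.Adj t x) (B : ℕ) :
    HasUnitSteps t fun i => C.far r B (ident (x i)) := fun i hi =>
  ⟨hR.far_le (hxR i (by lia)) (hx.rel_succ hi) B, hR.far_le (hxR _ hi) (hx.rel_succ hi).symm B⟩

theorem add_le_of_label_ne (hR : IsAcceptedRegion G ident F r C R)
    (hxR : ∀ i < t, x i ∈ R) (hx : IsInducedPath G.Adj t x) {i j : ℕ} (hij : i < j) (hj : j < t)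
    (hi₀ : C.label (ident (x i)) ≠ 0) (hj₀ : C.label (ident (x j)) ≠ 0)
    (hlabel : C.label (ident (x i)) ≠ C.label (ident (x j))) : i + (2 * r + 1) ≤ j := by
  obtain ⟨d, rfl⟩ := Nat.exists_eq_add_of_le hij.le
  have hsteps := (hR.hasUnitSteps_far hxR hx (C.label (ident (x (i + d))))).le_add hj
  have hother := hR.le_far (hxR i (by lia)) hi₀ hlabel.symm
  have hown := hR.far_own (hxR _ hj) hj₀
  lia

theorem exists_repeated_label (hR : IsAcceptedRegion G ident F r C R)
    (hxR : ∀ i < 4 * r + 3, x i ∈ R) (hx : IsInducedPath G.Adj (4 * r + 3) x) (hv : v ∈ R) :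
    ∃ i j, i < j ∧ j < 4 * r + 3 ∧ C.label (ident (x i)) = C.label (ident (x j)) ∧
      C.label (ident (x i)) ≠ 0 ∧ C.label (ident (x i)) ≠ C.label (ident v) := by
  by_contra hcon
  refine hcon <| (hR.accepts v hv).free (fun i => ident (x i))
    (fun i hi => (hR.accepts _ (hxR i hi)).isVertex) ?_
  refine ((hR.isFaithful hv).isInducedPath_iff hR.injective (fun _ _ => rfl) hxR
    fun i j hij hj hlabel => ?_).2 hx
  by_contra! hne
  exact hcon ⟨i, j, hij, hj, hlabel, hne⟩

theorem label_trichotomy (hR : IsAcceptedRegion G ident F r C R)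
    (hxR : ∀ i < 4 * r + 3, x i ∈ R) (hx : IsInducedPath G.Adj (4 * r + 3) x) {a₁ a b b₂ i : ℕ}
    (ha₁ : a₁ < a) (hab : a < b) (hb₂ : b < b₂) (hN : b₂ < 4 * r + 3)
    (ha₀ : C.label (ident (x a)) ≠ 0) (hb₀ : C.label (ident (x b)) ≠ 0)
    (hne : C.label (ident (x a)) ≠ C.label (ident (x b))) (hi : i < 4 * r + 3) :
    C.label (ident (x i)) = 0 ∨ C.label (ident (x i)) = C.label (ident (x a)) ∨
      C.label (ident (x i)) = C.label (ident (x b)) := by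
  by_contra! hcon
  obtain ⟨hi₀, hia, hib⟩ := hcon
  have hsep {j l : ℕ} := hR.add_le_of_label_ne hxR hx (i := j) (j := l)
  have := hsep hab (by lia) ha₀ hb₀ hne
  rcases lt_trichotomy i a with h | rfl | h
  · have := hsep h (by lia) hi₀ ha₀ hia
    lia
  · exact hia rfl
  rcases lt_trichotomy i b with h' | rfl | h'
  · have := hsep h' (by lia) hi₀ hb₀ hib
    have := hsep h hi ha₀ hi₀ hia.symm
    lia
  · exact hib rfl
  · have := hsep h' hi hb₀ hi₀ hib.symm
    lia

theorem exists_crossing (hR : IsAcceptedRegion G ident F r C R)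
    (hxR : ∀ i < 4 * r + 3, x i ∈ R) (hx : IsInducedPath G.Adj (4 * r + 3) x) {a₁ a₂ b₁ b₂ : ℕ}
    (ha : a₁ < a₂) (hab : a₂ < b₁) (hb : b₁ < b₂) (hN : b₂ < 4 * r + 3)
    (ha_eq : C.label (ident (x a₁)) = C.label (ident (x a₂)))
    (hb_eq : C.label (ident (x b₁)) = C.label (ident (x b₂)))
    (ha₀ : C.label (ident (x a₂)) ≠ 0) (hb₀ : C.label (ident (x b₁)) ≠ 0)
    (hne : C.label (ident (x a₂)) ≠ C.label (ident (x b₁))) {far : ℕ → ℕ}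
    (hfar : ∀ i, far i = C.far r (C.label (ident (x b₁))) (ident (x i))) :
    ∃ y < b₁, (∀ i < y, far y < far i) ∧ (∀ j < 4 * r + 3, y < j → far j < far y) ∧
      (∀ i < y + 1, C.label (ident (x i)) = 0 ∨
        C.label (ident (x i)) = C.label (ident (x a₂))) ∧
      ∀ i < 4 * r + 3, y ≤ i → C.label (ident (x i)) = 0 ∨
        C.label (ident (x i)) = C.label (ident (x b₁)) := by
  have hfarA (i) (hi : i < 4 * r + 3) (h : C.label (ident (x i)) = C.label (ident (x a₂))) :
      2 * r + 1 ≤ far i :=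
    hfar i ▸ hR.le_far (hxR i hi) (h ▸ ha₀) (h.trans_ne hne).symm
  have hfarB (i) (hi : i < 4 * r + 3) (h : C.label (ident (x i)) = C.label (ident (x b₁))) :
      far i = 0 := by
    rw [hfar, ← h]
    exact hR.far_own (hxR i hi) (h ▸ hb₀)
  have hsteps : HasUnitSteps (4 * r + 3) far := by
    simpa only [← hfar] using hR.hasUnitSteps_far hxR hx (C.label (ident (x b₁)))
  obtain ⟨y, hyb, hy, hbefore, hafter⟩ := hsteps.exists_unique_crossing
    ha hab hb hN (hfarA a₁ (by lia) ha_eq) (hfarA a₂ (by lia) rfl) (hfarB b₁ (by lia) rfl)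
    (hfarB b₂ hN hb_eq.symm)
  have hpos := hafter b₁ (by lia) hyb
  have htrichotomy {i} := hR.label_trichotomy hxR hx ha hab hb hN ha₀ hb₀ hne (i := i)
  refine ⟨y, hyb, hbefore, hafter, fun i hi => ?_, fun i hi hyi => ?_⟩
  · rcases htrichotomy (show i < 4 * r + 3 by lia) with h | h | h
    · exact .inl h
    · exact .inr h
    · have := hfarB i (by lia) h
      rcases (Nat.lt_succ_iff.1 hi).eq_or_lt with rfl | hiy
      · lia
      · have := hbefore i hiy
        lia
  · rcases htrichotomy hi with h | h | h
    · exact .inl h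
    · have := hfarA i hi h
      rcases hyi.eq_or_lt with rfl | hyi
      · lia
      · have := hafter i hi hyi
        lia
    · exact .inr h

theorem not_isInducedPath_of_repeated_labels (hR : IsAcceptedRegion G ident F r C R)
    (hxR : ∀ i < 4 * r + 3, x i ∈ R) {a₁ a₂ b₁ b₂ : ℕ} (ha : a₁ < a₂) (hab : a₂ < b₁)
    (hb : b₁ < b₂) (hN : b₂ < 4 * r + 3) (ha_eq : C.label (ident (x a₁)) = C.label (ident (x a₂)))
    (hb_eq : C.label (ident (x b₁)) = C.label (ident (x b₂)))
    (ha₀ : C.label (ident (x a₂)) ≠ 0) (hb₀ : C.label (ident (x b₁)) ≠ 0)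
    (hne : C.label (ident (x a₂)) ≠ C.label (ident (x b₁))) :
    ¬ IsInducedPath G.Adj (4 * r + 3) x := by
  intro hx
  obtain ⟨y, hyb, hbefore, hafter, hlabelA, hlabelB⟩ :=
    hR.exists_crossing hxR hx ha hab hb hN ha_eq hb_eq ha₀ hb₀ hne fun _ => rfl
  obtain ⟨t, ht⟩ : ∃ t, y + (t + 1) = 4 * r + 3 := ⟨4 * r + 2 - y, by lia⟩
  have hsecond : t + 1 ≤ C.reach (C.label (ident (x b₁))) (ident (x y)) :=
    hR.le_reach (x := fun i => x (y + i)) (hxR b₁ (by lia)) hb₀ (fun i hi => hxR _ (by lia))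
      (fun i hi => hlabelB _ (by lia) (by lia)) (ht ▸ hx).shift
      fun i hi hit => hafter _ (by lia) (by lia)
  have hfirst : y + C.reach (C.label (ident (x b₁))) (ident (x y)) < 4 * r + 3 :=
    hR.add_reach_lt (hxR a₂ (by lia)) ha₀ hne.symm (fun i hi => hxR i (by lia)) hlabelA
      (hx.mono (by lia)) hbefore
  lia

theorem not_isInducedPath (hR : IsAcceptedRegion G ident F r C R)
    (hxR : ∀ i < 4 * r + 3, x i ∈ R) : ¬ IsInducedPath G.Adj (4 * r + 3) x := by
  intro hx
  obtain ⟨b₁, b₂, hb, hb₂, hb_eq, hb₀, -⟩ := hR.exists_repeated_label hxR hx (hxR 0 (by lia))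
  obtain ⟨a₁, a₂, ha, ha₂, ha_eq, ha₀, hab⟩ :=
    hR.exists_repeated_label hxR hx (hxR b₁ (by lia))
  have hsep {i j} := hR.add_le_of_label_ne hxR hx (i := i) (j := j)
  have hclose {i j} (hi : i < 4 * r + 3) (hj : j < 4 * r + 3)
      (hiA : C.label (ident (x i)) = C.label (ident (x a₁)))
      (hjB : C.label (ident (x j)) = C.label (ident (x b₁))) :
      i + (2 * r + 1) ≤ j ∨ j + (2 * r + 1) ≤ i := by
    rcases lt_trichotomy i j with h | rfl | h
    · exact .inl (hsep h hj (hiA ▸ ha₀) (hjB ▸ hb₀) (by rwa [hiA, hjB]))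
    · exact absurd (hiA.symm.trans hjB) hab
    · exact .inr (hsep h hi (hjB ▸ hb₀) (hiA ▸ ha₀) (by rw [hiA, hjB]; exact hab.symm))
  have := hclose (i := a₁) (j := b₁) (by lia) (by lia) rfl rfl
  have := hclose (i := a₁) (j := b₂) (by lia) (by lia) rfl hb_eq.symm
  have := hclose (i := a₂) (j := b₁) (by lia) (by lia) ha_eq.symm rfl
  have := hclose (i := a₂) (j := b₂) (by lia) (by lia) ha_eq.symm hb_eq.symm
  obtain h | h : a₂ < b₁ ∨ b₂ < a₁ := by lia
  · exact hR.not_isInducedPath_of_repeated_labels hxR ha h hb hb₂ ha_eq hb_eq (ha_eq ▸ ha₀) hb₀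
      (ha_eq ▸ hab) hx
  · exact hR.not_isInducedPath_of_repeated_labels hxR hb h ha ha₂ hb_eq ha_eq (hb_eq ▸ hb₀) ha₀
      (hb_eq ▸ hab.symm) hx

end Path

end IsAcceptedRegion

theorem map_eq_of_reachable (hident : Function.Injective ident)
    (h : ∀ v, (certificateView G ident F r v).Accepts r (F v).map) {u v : V}
    (huv : G.Reachable u v) : (F v).map = (F u).map := by
  obtain ⟨p⟩ := huv
  induction p with
  | nil => rfl
  | cons hadj p ih =>
    rw [ih]
    exact (h _).map_eq _ _ ((center_mem_edges_iff hident).2 ⟨_, hadj, rfl⟩)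
      (mk_mem_labels (edist_le_add_one (by simp) hadj))

theorem isInducedPathFree_of_forall_verifies (hr : 0 < r) (hident : Function.Injective ident)
    (h : ∀ v, (certificateView G ident F r v).Verifies r) :
    IsInducedPathFree (4 * r + 3) V G := by
  by_contra hpath
  obtain ⟨x, hx⟩ := (not_isInducedPathFree_iff (by lia)).1 hpath
  have haccepts (v : V) : (certificateView G ident F r v).Accepts r (F v).map := by
    obtain ⟨F', hF', hv⟩ := h v
    obtain ⟨w, -, hw, rfl⟩ := exists_of_mem_labels_encode hF'
    exact hident hw ▸ hv
  have hregion : IsAcceptedRegion G ident F r (F (x 0)).map {v | G.Reachable (x 0) v} :=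
    ⟨hr, hident, fun u hu v huv => hu.trans huv,
      fun v hv => map_eq_of_reachable hident haccepts hv ▸ haccepts v⟩
  refine hregion.not_isInducedPath (fun i hi => ?_) hx
  induction i with
  | zero => exact SimpleGraph.Reachable.refl _
  | succ i ih => exact (ih (by lia)).trans (hx.rel_succ hi).reachable

end Soundness

/-! ### Clusters of vertices of high degree -/

section Clusters

variable {V : Type*} (G : SimpleGraph V) (q r : ℕ)

/-- The vertices of high degree, which are those that belong to a cluster. -/
def IsHigh (u : V) : Prop := q ≤ (G.neighborSet u).ncard

/-- Vertices of high degree at distance at most `2 * r`. Its components that contain a high vertex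
are the clusters, so that distinct clusters are at distance at least `2 * r + 1`. -/
def linkGraph : SimpleGraph V where
  Adj u v := u ≠ v ∧ IsHigh G q u ∧ IsHigh G q v ∧ G.edist u v ≤ (2 * r : ℕ)
  symm := ⟨fun _ _ ⟨hne, hu, hv, h⟩ => ⟨hne.symm, hv, hu, SimpleGraph.edist_comm ▸ h⟩⟩
  loopless := ⟨fun _ h => h.1 rfl⟩

/-- A vertex chosen in the component of `u`, which stands for the cluster of `u`. -/
noncomputable def clusterRoot (u : V) : V := ((linkGraph G q r).connectedComponentMk u).out

/-- The depth of `u` in a breadth-first tree of its cluster. -/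
noncomputable def clusterDepth (u : V) : ℕ := (linkGraph G q r).dist u (clusterRoot G q r u)

/-- The distance of `v` to the cluster with root `c`, truncated at `2 * r + 1`. -/
noncomputable def clusterFar (c v : V) : ℕ :=
  sInf (insert (2 * r + 1) {d | ∃ u, IsHigh G q u ∧ clusterRoot G q r u = c ∧ G.edist v u ≤ d})

/-- The induced paths on `t` vertices which start at `v` and then stay closer to the cluster with
root `c` than `v`. -/
def IsDescendingPath (c v : V) (t : ℕ) (x : ℕ → V) : Prop :=
  x 0 = v ∧ IsInducedPath G.Adj t x ∧
    ∀ i, 0 < i → i < t → clusterFar G q r c (x i) < clusterFar G q r c v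

/-- The order of a longest induced path from `v` that then stays closer to the cluster with
root `c`. -/
noncomputable def clusterReach (c v : V) : ℕ := sSup {t | ∃ x, IsDescendingPath G q r c v t x}

open Classical in
/-- The roots of the clusters. -/
noncomputable def clusterRoots [Fintype V] : Finset V :=
  Finset.univ.filter fun c => ∃ u, IsHigh G q u ∧ clusterRoot G q r u = c

variable {G q r}

theorem reachable_clusterRoot (u : V) : (linkGraph G q r).Reachable u (clusterRoot G q r u) :=
  (SimpleGraph.ConnectedComponent.exact (Quot.out_eq _)).symm

theorem clusterRoot_eq_of_reachable {u v : V} (h : (linkGraph G q r).Reachable u v) :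
    clusterRoot G q r u = clusterRoot G q r v := by
  rw [clusterRoot, clusterRoot, SimpleGraph.ConnectedComponent.sound h]

theorem clusterRoot_eq_of_edist_le {u v : V} (hu : IsHigh G q u) (hv : IsHigh G q v)
    (h : G.edist u v ≤ (2 * r : ℕ)) : clusterRoot G q r u = clusterRoot G q r v := by
  by_cases huv : u = v
  · rw [huv]
  · have hadj : (linkGraph G q r).Adj u v := ⟨huv, hu, hv, h⟩
    exact clusterRoot_eq_of_reachable hadj.reachable

theorem exists_edist_le_of_edist_le_add {u v : V} {d e : ℕ} (h : G.edist u v ≤ (d + e : ℕ)) :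
    ∃ x, G.edist x u ≤ d ∧ G.edist x v ≤ e := by
  obtain ⟨p, hp⟩ :=
    SimpleGraph.exists_walk_of_edist_ne_top (h.trans_lt (ENat.natCast_lt_top _)).ne
  rw [← hp, Nat.cast_le] at h
  refine ⟨p.getVert d, ?_, (SimpleGraph.edist_le (p.drop d)).trans (Nat.cast_le.2 ?_)⟩
  · rw [SimpleGraph.edist_comm]
    refine (SimpleGraph.edist_le (p.take d)).trans (Nat.cast_le.2 ?_)
    simp
  · rw [SimpleGraph.Walk.drop_length]
    lia

theorem exists_clusterParent {u : V} (hroot : u ≠ clusterRoot G q r u) :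
    ∃ p x, IsHigh G q p ∧ clusterRoot G q r p = clusterRoot G q r u ∧
      clusterDepth G q r p < clusterDepth G q r u ∧ G.edist x u ≤ r ∧ G.edist x p ≤ r := by
  obtain ⟨w, hw⟩ := (reachable_clusterRoot (G := G) (q := q) (r := r) u).exists_walk_length_eq_dist
  obtain ⟨p, hup, w', rfl⟩ := w.exists_eq_cons_of_ne hroot
  obtain ⟨x, hxu, hxp⟩ := exists_edist_le_of_edist_le_add (hup.2.2.2.trans_eq (by rw [two_mul]))
  have hpu := (clusterRoot_eq_of_reachable hup.reachable).symm
  refine ⟨p, x, hup.2.2.1, hpu, ?_, hxu, hxp⟩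
  rw [clusterDepth, clusterDepth, ← hw, hpu]
  exact (SimpleGraph.dist_le w').trans_lt (by simp)

theorem clusterFar_le_succ_of_adj {u v : V} (h : G.Adj u v) (c : V) :
    clusterFar G q r c u ≤ clusterFar G q r c v + 1 := by
  rcases Nat.sInf_mem (Set.insert_nonempty (2 * r + 1)
    {d : ℕ | ∃ u, IsHigh G q u ∧ clusterRoot G q r u = c ∧ G.edist v u ≤ d}) with
    hv | ⟨w, hw, hwc, hvw⟩
  · have hu : clusterFar G q r c u ≤ 2 * r + 1 := Nat.sInf_le (Set.mem_insert _ _)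
    have hv : clusterFar G q r c v = 2 * r + 1 := hv
    lia
  · refine Nat.sInf_le (Or.inr ⟨w, hw, hwc, ?_⟩)
    refine (SimpleGraph.edist_triangle (v := v)).trans ?_
    rw [SimpleGraph.edist_eq_one_iff_adj.2 h, add_comm, Nat.cast_succ]
    exact add_le_add_left hvw 1

theorem exists_edist_le_clusterFar {c v : V} (h : clusterFar G q r c v < 2 * r + 1) :
    ∃ u, IsHigh G q u ∧ clusterRoot G q r u = c ∧ G.edist v u ≤ clusterFar G q r c v :=
  (Nat.sInf_mem (Set.insert_nonempty _ _)).resolve_left h.ne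

theorem clusterFar_le (c v : V) : clusterFar G q r c v ≤ 2 * r + 1 :=
  Nat.sInf_le (Set.mem_insert _ _)

theorem clusterFar_clusterRoot_self {u : V} (hu : IsHigh G q u) :
    clusterFar G q r (clusterRoot G q r u) u = 0 :=
  Nat.sInf_eq_zero.2 (Or.inl (Or.inr ⟨u, hu, rfl, by simp⟩))

theorem le_clusterFar {u c : V} (hu : IsHigh G q u) (hc : c ≠ clusterRoot G q r u) :
    2 * r + 1 ≤ clusterFar G q r c u := by
  by_contra! hlt
  obtain ⟨v, hv, rfl, huv⟩ := exists_edist_le_clusterFar hlt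
  exact hc (clusterRoot_eq_of_edist_le hu hv (huv.trans (Nat.cast_le.2 (by lia)))).symm

theorem bddAbove_descendingPath [Finite V] (c v : V) :
    BddAbove {t | ∃ x, IsDescendingPath G q r c v t x} := by
  cases nonempty_fintype V
  exact ⟨Fintype.card V, fun _ ⟨_, hx⟩ => hx.2.1.le_card⟩

theorem le_clusterReach [Finite V] {c v : V} {t : ℕ} {x : ℕ → V}
    (hx : IsDescendingPath G q r c v t x) :
    t ≤ clusterReach G q r c v :=
  le_csSup (bddAbove_descendingPath c v) ⟨x, hx⟩

theorem exists_isDescendingPath_clusterReach [Finite V] (c v : V) :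
    ∃ x, IsDescendingPath G q r c v (clusterReach G q r c v) x :=
  have hzero : IsDescendingPath G q r c v 0 fun _ => v :=
    ⟨rfl, fun _ _ _ h => by lia, fun _ _ h => by lia⟩
  show clusterReach G q r c v ∈ {t | ∃ x, IsDescendingPath G q r c v t x} from
    Nat.sSup_mem ⟨0, _, hzero⟩ (bddAbove_descendingPath c v)

section Finite

variable [Fintype V]

theorem dist_lt_card (G : SimpleGraph V) (u v : V) : G.dist u v < Fintype.card V := by
  by_cases h : G.Reachable u v
  · obtain ⟨p, hp, hlen⟩ := h.exists_path_of_dist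
    exact hlen ▸ hp.length_lt
  · rw [SimpleGraph.dist_eq_zero_of_not_reachable h]
    exact Fintype.card_pos_iff.2 ⟨u⟩

theorem clusterFar_lt_card {c v : V} (h : clusterFar G q r c v < 2 * r + 1) :
    clusterFar G q r c v < Fintype.card V := by
  obtain ⟨u, hu, huc, hvu⟩ := exists_edist_le_clusterFar h
  have hreach := SimpleGraph.edist_ne_top_iff_reachable.1 (hvu.trans_lt (ENat.natCast_lt_top _)).ne
  refine (Nat.sInf_le (Or.inr ⟨u, hu, huc, ?_⟩)).trans_lt (dist_lt_card G v u)
  rw [hreach.coe_dist_eq_edist]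

theorem clusterReach_le_card (c v : V) : clusterReach G q r c v ≤ Fintype.card V := by
  obtain ⟨x, hx⟩ := exists_isDescendingPath_clusterReach (G := G) (q := q) (r := r) c v
  exact hx.2.1.le_card

theorem mem_clusterRoots {c : V} :
    c ∈ clusterRoots G q r ↔ ∃ u, IsHigh G q u ∧ clusterRoot G q r u = c := by
  simp [clusterRoots]

/-- Distinct clusters have disjoint neighbourhoods. -/
theorem card_clusterRoots_mul_le (hr : 1 ≤ r) :
    (clusterRoots G q r).card * q ≤ Fintype.card V := by
  classical
  rcases isEmpty_or_nonempty V with _ | _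
  · simp [Finset.eq_empty_of_isEmpty]
  choose! u hu huc using fun c (hc : c ∈ clusterRoots G q r) => mem_clusterRoots.1 hc
  have hdisj : Set.PairwiseDisjoint (clusterRoots G q r : Set V)
      fun c => (G.neighborSet (u c)).toFinite.toFinset := by
    intro c hc c' hc' hne
    refine Finset.disjoint_left.2 fun x hx hx' => hne ?_
    rw [Set.Finite.mem_toFinset, SimpleGraph.mem_neighborSet] at hx hx'
    rw [← huc c hc, ← huc c' hc']
    refine clusterRoot_eq_of_edist_le (hu c hc) (hu c' hc') ?_
    refine (SimpleGraph.edist_triangle (v := x)).trans ?_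
    rw [SimpleGraph.edist_eq_one_iff_adj.2 hx, SimpleGraph.edist_eq_one_iff_adj.2 hx'.symm]
    exact_mod_cast (by lia : 1 + 1 ≤ 2 * r)
  calc (clusterRoots G q r).card * q
      ≤ ∑ c ∈ clusterRoots G q r, (G.neighborSet (u c)).toFinite.toFinset.card :=
        Finset.card_nsmul_le_sum _ _ _ fun c hc => by
          rw [← Set.ncard_eq_toFinset_card]
          exact hu c hc
    _ = _ := (Finset.card_biUnion hdisj).symm
    _ ≤ Fintype.card V := Finset.card_le_univ _

end Finite

end Clusters

/-! ### Completeness of the verifier -/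

theorem sInf_setOf_eq {P : ℕ → Prop} {x : ℕ} (h : ∀ y, P y ↔ y = x) : sInf {y | P y} = x := by
  simp only [h, Set.ofPred_eq_eq_singleton, csInf_singleton]

/-- The choices made when the certificates of `G` are written: the vertex `mid u` that compares the
rows read by `u` and by its parent, and a distribution of the rows, where each vertex stores the
rows of the vertices whose group is its colour. -/
structure Layout {V : Type} [Fintype V] (G : SimpleGraph V) (q r m : ℕ) where
  mid : V → V
  colour : V → Fin m
  group : V → Fin m
  exists_parent : ∀ u, u ≠ clusterRoot G q r u → ∃ p, IsHigh G q p ∧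
    clusterRoot G q r p = clusterRoot G q r u ∧ clusterDepth G q r p < clusterDepth G q r u ∧
    G.edist (mid u) u ≤ r ∧ G.edist (mid u) p ≤ r
  exists_adj_colour : ∀ u, IsHigh G q u → ∀ i, ∃ w, G.Adj u w ∧ colour w = i
  ncard_group_le : ∀ i, {z | group z = i}.ncard ≤ Fintype.card V / m + 1

namespace Layout

variable {V : Type} [Fintype V] {G : SimpleGraph V} {q r m : ℕ} (L : Layout G q r m)
  {ident : V → ℕ}

open Classical in
/-- The map of the clusters of `G`. -/
noncomputable def map (ident : V → ℕ) : ClusterMap :=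
  Finset.univ.image (fun u =>
    .label (ident u) (if IsHigh G q u then ident (clusterRoot G q r u) else 0)) ∪
  Finset.univ.image (fun u => .depth (ident u) (clusterDepth G q r u)) ∪
  (Finset.univ.filter fun u => IsHigh G q u ∧ u ≠ clusterRoot G q r u).image
    (fun u => .mid (ident u) (ident (L.mid u))) ∪
  ((clusterRoots G q r ×ˢ Finset.univ).filter fun p => clusterFar G q r p.1 p.2 < 2 * r + 1).image
    (fun p => .far (ident p.1) (ident p.2) (clusterFar G q r p.1 p.2)) ∪
  (clusterRoots G q r ×ˢ Finset.univ).image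
    (fun p => .reach (ident p.1) (ident p.2) (clusterReach G q r p.1 p.2)) ∪
  (Finset.univ.filter fun p : V × V => ¬ IsHigh G q p.1 ∧ G.Adj p.1 p.2).image
    (fun p => .lowAdj (ident p.1) (ident p.2))

open Classical in
/-- The certificate of the vertex `w`. -/
noncomputable def certificate (ident : V → ℕ) (w : V) : Certificate where
  map := L.map ident
  rows := (Finset.univ.filter fun p : V × V => L.group p.1 = L.colour w ∧ G.Adj p.1 p.2).image
    (fun p => (ident p.1, ident p.2))

/-- The view of `v` in the network with these certificates. -/
noncomputable abbrev view (ident : V → ℕ) (v : V) : LocalView :=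
  certificateView G ident (L.certificate ident) r v

theorem isVertex_iff {a : ℕ} : (L.map ident).IsVertex a ↔ ∃ u, ident u = a := by
  simp [ClusterMap.IsVertex, map]

theorem far_of_forall_ne {B a : ℕ} (hB : ∀ c, ident c ≠ B) :
    (L.map ident).far r B a = 2 * r + 1 := by
  simp [ClusterMap.far, map, hB]

theorem reach_of_forall_ne {B a : ℕ} (hB : ∀ c ∈ clusterRoots G q r, ident c ≠ B) :
    (L.map ident).reach B a = 0 := by
  refine Nat.sInf_eq_zero.2 (Or.inr (Set.eq_empty_of_forall_notMem fun t ht => ?_))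
  obtain ⟨c, -, hc, hcB, -⟩ : ∃ c v, c ∈ clusterRoots G q r ∧ ident c = B ∧ ident v = a ∧
      clusterReach G q r c v = t := by
    simpa [map] using ht
  exact hB c hc hcB

section Injective

variable (hident : Function.Injective ident)
include hident

open Classical in
theorem label_ident (u : V) :
    (L.map ident).label (ident u) = if IsHigh G q u then ident (clusterRoot G q r u) else 0 := by
  refine sInf_setOf_eq fun l => ?_
  simp [map, hident.eq_iff, eq_comm]

theorem depth_ident (u : V) : (L.map ident).depth (ident u) = clusterDepth G q r u := by
  refine sInf_setOf_eq fun d => ?_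
  simp [map, hident.eq_iff, eq_comm]

theorem mid_ident {u : V} (hu : IsHigh G q u) (hroot : u ≠ clusterRoot G q r u) :
    (L.map ident).mid (ident u) = ident (L.mid u) := by
  refine sInf_setOf_eq fun x => ?_
  simp [map, hident.eq_iff, hu, hroot, eq_comm]

theorem far_ident (c v : V) :
    (L.map ident).far r (ident c) (ident v) = clusterFar G q r c v := by
  have hmem (d : ℕ) : MapEntry.far (ident c) (ident v) d ∈ L.map ident ↔
      clusterFar G q r c v < 2 * r + 1 ∧ d = clusterFar G q r c v := by
    have hroot (h : clusterFar G q r c v < 2 * r + 1) : c ∈ clusterRoots G q r := by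
      obtain ⟨u, hu, huc, -⟩ := exists_edist_le_clusterFar h
      exact mem_clusterRoots.2 ⟨u, hu, huc⟩
    have hentry : MapEntry.far (ident c) (ident v) d ∈ L.map ident ↔
        (c ∈ clusterRoots G q r ∧ clusterFar G q r c v < 2 * r + 1) ∧
          clusterFar G q r c v = d := by
      simp [map, hident.eq_iff, and_assoc]
    rw [hentry, and_iff_right_of_imp hroot, eq_comm (b := d)]
  rw [ClusterMap.far]
  simp only [hmem]
  rcases (clusterFar_le (G := G) (q := q) (r := r) c v).lt_or_eq with h | h
  · simp only [h, true_and, Set.ofPred_eq_eq_singleton, csInf_pair, min_eq_right h.le]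
  · simp [h]

theorem reach_ident {c : V} (hc : c ∈ clusterRoots G q r) (v : V) :
    (L.map ident).reach (ident c) (ident v) = clusterReach G q r c v := by
  refine sInf_setOf_eq fun t => ?_
  simp [map, hident.eq_iff, hc, eq_comm]

theorem lowAdj_ident_iff {u : V} {b : ℕ} :
    MapEntry.lowAdj (ident u) b ∈ L.map ident ↔ ¬ IsHigh G q u ∧ b ∈ ident '' G.neighborSet u := by
  simp [map, hident.eq_iff, and_assoc]

theorem reads_certificate_iff {u z : V} (hu : IsHigh G q u) (hz : IsHigh G q z) {S : Set ℕ} :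
    Reads G (L.certificate ident) u (ident z) S ↔ S = ident '' G.neighborSet z := by
  have hrow {w : V} (hw : L.colour w = L.group z) :
      (L.certificate ident w).row (ident z) = ident '' G.neighborSet z := by
    ext b
    simp [certificate, Certificate.row, hident.eq_iff, hw]
  constructor
  · rintro ⟨w, -, rfl, b, hb⟩
    refine hrow ?_
    obtain ⟨_, ⟨hw, -⟩, -⟩ : ∃ y, (L.group z = L.colour w ∧ G.Adj z y) ∧ ident y = b := by
      simpa [certificate, Certificate.row, hident.eq_iff] using hb
    exact hw.symm
  · rintro rfl
    obtain ⟨w, huw, hw⟩ := L.exists_adj_colour u hu (L.group z)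
    obtain ⟨y, hzy, -⟩ := L.exists_adj_colour z hz (L.group z)
    exact ⟨w, huw, hrow hw, ident y, y, hzy, rfl⟩

theorem label_ident_of_isHigh {u : V} (hu : IsHigh G q u) :
    (L.map ident).label (ident u) = ident (clusterRoot G q r u) := by
  rw [L.label_ident hident, if_pos hu]

theorem isHigh_of_label_ne_zero {u : V} (h : (L.map ident).label (ident u) ≠ 0) : IsHigh G q u := by
  by_contra hu
  exact h (by rw [L.label_ident hident, if_neg hu])

theorem not_isHigh_of_label_eq_zero (hpos : ∀ v, 0 < ident v) {u : V}
    (h : (L.map ident).label (ident u) = 0) : ¬ IsHigh G q u := fun hu =>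
  (hpos _).ne' ((L.label_ident_of_isHigh hident hu).symm.trans h)

theorem exists_isHigh_of_label_ne_zero {a : ℕ} (h : (L.map ident).label a ≠ 0) :
    ∃ u, ident u = a ∧ IsHigh G q u := by
  by_cases ha : (L.map ident).IsVertex a
  · obtain ⟨u, rfl⟩ := L.isVertex_iff.1 ha
    exact ⟨u, rfl, L.isHigh_of_label_ne_zero hident h⟩
  · exact absurd (ClusterMap.label_eq_zero_of_not_isVertex ha) h

theorem far_le_of_adj {u v : V} (h : G.Adj u v) (B : ℕ) :
    (L.map ident).far r B (ident u) ≤ (L.map ident).far r B (ident v) + 1 := by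
  by_cases hB : ∃ c, ident c = B
  · obtain ⟨c, rfl⟩ := hB
    rw [L.far_ident hident, L.far_ident hident]
    exact clusterFar_le_succ_of_adj h c
  · rw [L.far_of_forall_ne (not_exists.1 hB), L.far_of_forall_ne (not_exists.1 hB)]
    lia

theorem isFaithful (hr : 1 ≤ r) (hpos : ∀ v, 0 < ident v) (v : V) :
    (L.view ident v).IsFaithful G ident Set.univ (L.map ident) where
  lowAdj_iff u _ hu w := by
    rw [L.lowAdj_ident_iff hident, hident.mem_set_image]
    exact and_iff_right (L.not_isHigh_of_label_eq_zero hident hpos hu)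
  not_adj u _ w _ hu hw hne hadj := by
    have hu := L.isHigh_of_label_ne_zero hident hu
    have hw := L.isHigh_of_label_ne_zero hident hw
    rw [L.label_ident_of_isHigh hident hu, L.label_ident_of_isHigh hident hw] at hne
    refine hne (congrArg ident (clusterRoot_eq_of_edist_le hu hw ?_))
    rw [SimpleGraph.edist_eq_one_iff_adj.2 hadj]
    exact_mod_cast (by lia : 1 ≤ 2 * r)
  readsRow_iff u _ hu huv S := by
    have hv := L.isHigh_of_label_ne_zero hident (huv ▸ hu)
    exact (center_readsRow_iff hident).trans
      (L.reads_certificate_iff hident hv (L.isHigh_of_label_ne_zero hident hu))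

theorem exists_isInducedPath (hr : 1 ≤ r) (hpos : ∀ v, 0 < ident v) {v : V} {t : ℕ} {x : ℕ → ℕ}
    (hvertex : ∀ i < t, (L.map ident).IsVertex (x i))
    (hlabel : ∀ i j, i < j → j < t → (L.map ident).label (x i) = (L.map ident).label (x j) →
      (L.map ident).label (x i) = 0 ∨ (L.map ident).label (x i) = (L.map ident).label (ident v))
    (hx : IsInducedPath ((L.view ident v).KnownAdj (L.map ident)) t x) :
    ∃ y : ℕ → V, (∀ i < t, x i = ident (y i)) ∧ IsInducedPath G.Adj t y := by
  have hvertex' (i) (hi : i < t) : ∃ u, ident u = x i := L.isVertex_iff.1 (hvertex i hi)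
  have : Nonempty V := ⟨v⟩
  choose! y hy using hvertex'
  refine ⟨y, fun i hi => (hy i hi).symm, ?_⟩
  refine ((L.isFaithful hident hr hpos v).isInducedPath_iff hident (fun i hi => (hy i hi).symm)
    (fun _ _ => Set.mem_univ _) fun i j hij hj => ?_).1 hx
  rw [hy i (hij.trans hj), hy j hj]
  exact hlabel i j hij hj

theorem exists_isInducedPath_of_isKnown (hr : 1 ≤ r) (hpos : ∀ v, 0 < ident v) {v : V} {t : ℕ}
    {x : ℕ → ℕ} (hknown : ∀ i < t, (L.view ident v).IsKnown (L.map ident) (x i))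
    (hx : IsInducedPath ((L.view ident v).KnownAdj (L.map ident)) t x) :
    ∃ y : ℕ → V, (∀ i < t, x i = ident (y i)) ∧ IsInducedPath G.Adj t y :=
  L.exists_isInducedPath hident hr hpos (fun i hi => (hknown i hi).1)
    (fun i _ hij hj _ => (hknown i (hij.trans hj)).2) hx

theorem readsRow_unique (hpos : ∀ v, 0 < ident v) {v : V} (hv : IsHigh G q v) {z : ℕ}
    (hz : (L.map ident).label z = (L.map ident).label (ident v)) {S S' : Set ℕ}
    (hS : (L.view ident v).ReadsRow (ident v) z S)
    (hS' : (L.view ident v).ReadsRow (ident v) z S') : S = S' := by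
  rw [L.label_ident_of_isHigh hident hv] at hz
  obtain ⟨z, rfl, hzhigh⟩ := L.exists_isHigh_of_label_ne_zero hident (hz.trans_ne (hpos _).ne')
  rw [center_readsRow_iff hident, L.reads_certificate_iff hident hv hzhigh] at hS hS'
  rw [hS, hS']

theorem le_far {v : V} (hv : IsHigh G q v) {B : ℕ}
    (hB : B ≠ (L.map ident).label (ident v)) : 2 * r + 1 ≤ (L.map ident).far r B (ident v) := by
  rw [L.label_ident_of_isHigh hident hv] at hB
  by_cases hB' : ∃ c, ident c = B
  · obtain ⟨c, rfl⟩ := hB'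
    rw [L.far_ident hident]
    exact le_clusterFar hv fun h => hB (congrArg ident h)
  · rw [L.far_of_forall_ne (not_exists.1 hB')]

theorem le_reach {v : V} (hv : IsHigh G q v) {t : ℕ} {y : ℕ → V} (hy : IsInducedPath G.Adj t y)
    (hfar : ∀ i, 0 < i → i < t →
      (L.map ident).far r ((L.map ident).label (ident v)) (ident (y i)) <
        (L.map ident).far r ((L.map ident).label (ident v)) (ident (y 0))) :
    t ≤ (L.map ident).reach ((L.map ident).label (ident v)) (ident (y 0)) := by
  simp only [L.label_ident_of_isHigh hident hv, L.far_ident hident] at hfar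
  rw [L.label_ident_of_isHigh hident hv, L.reach_ident hident (mem_clusterRoots.2 ⟨v, hv, rfl⟩)]
  exact le_clusterReach ⟨rfl, hy, hfar⟩

/-- The concatenation of the two paths is induced, as the distance to the cluster separates them. -/
theorem add_reach_lt {t : ℕ} {y : ℕ → V} {B : ℕ}
    (hfree : ∀ y : ℕ → V, ¬ IsInducedPath G.Adj (4 * r + 3) y) (hy : IsInducedPath G.Adj (t + 1) y)
    (hfar : ∀ i < t, (L.map ident).far r B (ident (y t)) < (L.map ident).far r B (ident (y i))) :
    t + (L.map ident).reach B (ident (y t)) < 4 * r + 3 := by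
  by_contra! hlong
  by_cases hB : ∃ c ∈ clusterRoots G q r, ident c = B
  · obtain ⟨c, hc, rfl⟩ := hB
    rw [L.reach_ident hident hc] at hlong
    simp only [L.far_ident hident] at hfar
    obtain ⟨z, hz₀, hz, hzfar⟩ := exists_isDescendingPath_clusterReach (G := G) (q := q) (r := r)
      c (y t)
    exact hfree _ ((hy.append (fun _ _ hab => clusterFar_le_succ_of_adj hab c) hz hz₀.symm hfar
      (hz₀ ▸ hzfar)).mono hlong)
  · rw [L.reach_of_forall_ne fun c hc h => hB ⟨c, hc, h⟩] at hlong
    exact hfree y (hy.mono (by lia))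

theorem clusterAccepts (hr : 1 ≤ r) (hpos : ∀ v, 0 < ident v)
    (hfree : ∀ y : ℕ → V, ¬ IsInducedPath G.Adj (4 * r + 3) y) {v : V} (hv : IsHigh G q v) :
    (L.view ident v).ClusterAccepts r (L.map ident) where
  far_own := by
    change (L.map ident).far r ((L.map ident).label (ident v)) (ident v) = 0
    rw [L.label_ident_of_isHigh hident hv, L.far_ident hident, clusterFar_clusterRoot_self hv]
  far_other B hB := L.le_far hident hv hB
  readsRow_self := by
    refine (center_readsRow_iff hident).2 ((L.reads_certificate_iff hident hv hv).2 ?_)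
    exact Set.ext fun b =>
      center_mem_edges_iff (cert := Certificate.encode ∘ L.certificate ident) hident
  readsRow_unique z hz S S' hS hS' := L.readsRow_unique hident hpos hv hz hS hS'
  root_or_mid := by
    change ident v = (L.map ident).label (ident v) ∨
      ∃ F, ((L.map ident).mid (ident v), Certificate.encode F) ∈ _
    rw [L.label_ident_of_isHigh hident hv]
    by_cases hroot : v = clusterRoot G q r v
    · exact Or.inl (congrArg ident hroot)
    · obtain ⟨_, -, -, -, hmid, -⟩ := L.exists_parent v hroot
      rw [L.mid_ident hident hv hroot]
      rw [SimpleGraph.edist_comm] at hmid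
      exact Or.inr ⟨_, mk_mem_labels (hmid.trans (Nat.cast_le.2 r.le_succ))⟩
  le_reach x t hknown hx hfar := by
    obtain ⟨y, hxy, hy⟩ := L.exists_isInducedPath_of_isKnown hident hr hpos hknown hx
    rw [hxy 0 t.succ_pos]
    refine L.le_reach hident hv hy fun i hi hit => ?_
    rw [← hxy i hit, ← hxy 0 t.succ_pos]
    exact hfar i hi hit
  add_reach_lt B _ x t hknown hx hfar := by
    obtain ⟨y, hxy, hy⟩ := L.exists_isInducedPath_of_isKnown hident hr hpos hknown hx
    rw [hxy t t.lt_succ_self]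
    refine L.add_reach_lt hident hfree hy fun i hi => ?_
    rw [← hxy t t.lt_succ_self, ← hxy i (hi.trans t.lt_succ_self)]
    exact hfar i hi

theorem parent_of_mid (hpos : ∀ v, 0 < ident v) {v : V} {a : ℕ}
    (ha : (L.map ident).mid a = ident v) :
    ∃ p, (L.map ident).label p = (L.map ident).label a ∧
      (L.map ident).depth p < (L.map ident).depth a ∧
      ∀ z, (L.map ident).label z = (L.map ident).label a →
        ∃ S, (L.view ident v).ReadsRow a z S ∧ (L.view ident v).ReadsRow p z S := by
  have hmem : ∃ x, MapEntry.mid a x ∈ L.map ident := by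
    by_contra! h
    exact (hpos v).ne' (by simp [← ha, ClusterMap.mid, h])
  obtain ⟨u, ⟨hu, hroot⟩, rfl⟩ : ∃ u, (IsHigh G q u ∧ u ≠ clusterRoot G q r u) ∧ ident u = a := by
    obtain ⟨x, hx⟩ := hmem
    simp only [map, Finset.mem_union, Finset.mem_image, Finset.mem_filter, Finset.mem_univ,
      true_and, reduceCtorEq, and_false, exists_false, false_or, or_false, MapEntry.mid.injEq] at hx
    obtain ⟨u, hu, hua, -⟩ := hx
    exact ⟨u, hu, hua⟩
  rw [L.mid_ident hident hu hroot, hident.eq_iff] at ha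
  subst ha
  obtain ⟨p, hp, hpu, hdepth, hmidu, hmidp⟩ := L.exists_parent u hroot
  refine ⟨ident p, ?_, ?_, fun z hz => ?_⟩
  · rw [L.label_ident_of_isHigh hident hp, L.label_ident_of_isHigh hident hu, hpu]
  · rwa [L.depth_ident hident, L.depth_ident hident]
  · rw [L.label_ident_of_isHigh hident hu] at hz
    obtain ⟨z, rfl, hzhigh⟩ := L.exists_isHigh_of_label_ne_zero hident (hz.trans_ne (hpos _).ne')
    exact ⟨_, (readsRow_iff hident hmidu).2 ((L.reads_certificate_iff hident hu hzhigh).2 rfl),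
      (readsRow_iff hident hmidp).2 ((L.reads_certificate_iff hident hp hzhigh).2 rfl)⟩

theorem accepts (hr : 1 ≤ r) (hpos : ∀ v, 0 < ident v)
    (hfree : ∀ y : ℕ → V, ¬ IsInducedPath G.Adj (4 * r + 3) y) (v : V) :
    (L.view ident v).Accepts r (L.map ident) where
  map_eq w F _ hF := by
    obtain ⟨w, -, -, rfl⟩ := exists_of_mem_labels_encode hF
    rfl
  isVertex := L.isVertex_iff.2 ⟨v, rfl⟩
  lowAdj_iff hv b := by
    have hlow := L.not_isHigh_of_label_eq_zero hident hpos hv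
    exact (L.lowAdj_ident_iff hident).trans
      ((and_iff_right hlow).trans (center_mem_edges_iff hident).symm)
  far_le B w hw := by
    obtain ⟨w, hvw, rfl⟩ := (center_mem_edges_iff hident).1 hw
    exact L.far_le_of_adj hident hvw B
  parent_of_mid a ha := L.parent_of_mid hident hpos ha
  free x hx hpath := by
    by_contra! hcon
    obtain ⟨y, -, hy⟩ := L.exists_isInducedPath hident hr hpos hx
      (fun i j hij hj hlabel => or_iff_not_imp_left.2 (hcon i j hij hj hlabel)) hpath
    exact hfree y hy
  cluster hv := L.clusterAccepts hident hr hpos hfree (L.isHigh_of_label_ne_zero hident hv)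

end Injective

end Layout

/-! ### The size of the certificates -/

/-- The number of colours used on `n` vertices: about `√n / log n` of them, so that a random
colouring shows every colour to every vertex with at least `√n` neighbours. -/
def colorCount (n : ℕ) : ℕ := max 1 (Nat.sqrt n / (2 * (Nat.log 2 n + 1)))

theorem colorCount_pos (n : ℕ) : 0 < colorCount n := lt_max_of_lt_left one_pos

theorem two_pow_mul_pow_pred_le {m a d : ℕ} (hm : 0 < m) (hd : m * a ≤ d) :
    2 ^ a * (m - 1) ^ d ≤ m ^ d := by
  obtain ⟨b, rfl⟩ := Nat.exists_eq_add_of_le hd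
  calc 2 ^ a * (m - 1) ^ (m * a + b) = (2 * (m - 1) ^ m) ^ a * (m - 1) ^ b := by
        rw [pow_add, mul_pow, ← pow_mul, mul_assoc]
    _ ≤ (m ^ m) ^ a * m ^ b := by
        gcongr
        · exact two_mul_pow_pred_le hm
        · lia
    _ = m ^ (m * a + b) := by rw [pow_add, ← pow_mul]

theorem mul_colorCount_mul_pow_lt (n : ℕ) :
    n * colorCount n * (colorCount n - 1) ^ Nat.sqrt n < colorCount n ^ Nat.sqrt n := by
  rcases Nat.eq_zero_or_pos n with rfl | hn
  · simp
  have hm := colorCount_pos n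
  rcases (Nat.succ_le_iff.2 hm).eq_or_lt with hone | hone
  · simp [← hone, (Nat.sqrt_pos.2 hn).ne']
  have hdiv : colorCount n = Nat.sqrt n / (2 * (Nat.log 2 n + 1)) := by
    unfold colorCount at hone ⊢
    lia
  have hn_lt : n < 2 ^ (Nat.log 2 n + 1) := Nat.lt_pow_succ_log_self one_lt_two n
  have hm_le : colorCount n ≤ n := hdiv ▸ (Nat.div_le_self _ _).trans (Nat.sqrt_le_self n)
  have hmul_lt : n * colorCount n < 2 ^ (2 * (Nat.log 2 n + 1)) := by
    rw [two_mul, pow_add]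
    exact Nat.mul_lt_mul'' hn_lt (hm_le.trans_lt hn_lt)
  refine (Nat.mul_lt_mul_of_pos_right hmul_lt (pow_pos (by lia) _)).trans_le
    (two_pow_mul_pow_pred_le hm ?_)
  exact hdiv ▸ Nat.div_mul_le_self _ _

theorem div_colorCount_le (n : ℕ) :
    n / colorCount n ≤ 12 * ((Nat.log 2 n + 1) * Nat.sqrt n) := by
  rcases Nat.eq_zero_or_pos n with rfl | hn
  · simp
  have hq : 0 < Nat.sqrt n := Nat.sqrt_pos.2 hn
  have hm := colorCount_pos n
  have hsqrt_le : Nat.sqrt n ≤ 4 * (Nat.log 2 n + 1) * colorCount n := by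
    have hlt : Nat.sqrt n < 2 * (Nat.log 2 n + 1) * (colorCount n + 1) :=
      (Nat.lt_mul_div_succ _ (by lia)).trans_le
        (Nat.mul_le_mul_left _ (Nat.succ_le_succ (le_max_right _ _)))
    nlinarith
  refine Nat.div_le_of_le_mul ?_
  calc n ≤ 3 * Nat.sqrt n * Nat.sqrt n := by nlinarith [Nat.sqrt_le_add n]
    _ ≤ 3 * Nat.sqrt n * (4 * (Nat.log 2 n + 1) * colorCount n) := Nat.mul_le_mul_left _ hsqrt_le
    _ = _ := by ring

theorem pair_lt_two_pow {a b s : ℕ} (ha : a < 2 ^ s) (hb : b < 2 ^ s) :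
    Nat.pair a b < 2 ^ (2 * s) := by
  refine (Nat.pair_lt_max_add_one_sq a b).trans_le ?_
  rw [mul_comm, pow_mul]
  exact Nat.pow_le_pow_left (max_lt ha hb) 2

theorem Certificate.entryEmbedding_lt {e : MapEntry ⊕ ℕ × ℕ} {s : ℕ}
    (h : ((entry e).1.1 < 2 ^ s ∧ (entry e).1.2 < 2 ^ s) ∧
      (entry e).2.1 < 2 ^ s ∧ (entry e).2.2 < 2 ^ s) : entryEmbedding e < 2 ^ (4 * s) := by
  rw [show 4 * s = 2 * (2 * s) by ring]
  exact pair_lt_two_pow (pair_lt_two_pow h.1.1 h.1.2) (pair_lt_two_pow h.2.1 h.2.2)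

namespace Layout

theorem nonempty {V : Type} [Fintype V] (G : SimpleGraph V) (q r : ℕ) {m : ℕ} (hm : 0 < m)
    (hq : Fintype.card V * m * (m - 1) ^ q < m ^ q) : Nonempty (Layout G q r m) := by
  classical
  have : NeZero m := ⟨hm.ne'⟩
  have hparent (u : V) : ∃ x, u ≠ clusterRoot G q r u → ∃ p, IsHigh G q p ∧
      clusterRoot G q r p = clusterRoot G q r u ∧ clusterDepth G q r p < clusterDepth G q r u ∧
      G.edist x u ≤ r ∧ G.edist x p ≤ r := by
    by_cases hu : u = clusterRoot G q r u
    · exact ⟨u, fun h => absurd hu h⟩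
    · obtain ⟨p, x, hp⟩ := exists_clusterParent hu
      exact ⟨x, fun _ => ⟨p, hp⟩⟩
  choose mid hmid using hparent
  obtain ⟨colour, hcolour⟩ := exists_colouring_forall_surjOn (κ := Fin m) (d := q)
    (fun u : {u // IsHigh G q u} => (G.neighborSet u).toFinite.toFinset)
    (fun u => by rw [← Set.ncard_eq_toFinset_card]; exact u.2) (by
      rw [Fintype.card_fin]
      refine lt_of_le_of_lt ?_ hq
      gcongr
      exact Fintype.card_subtype_le _)
  obtain ⟨group, hgroup⟩ := exists_balanced_colouring V hm
  refine ⟨⟨mid, colour, group, hmid, fun u hu i => ?_, hgroup⟩⟩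
  simpa using hcolour ⟨u, hu⟩ (Set.mem_univ i)

variable {V : Type} [Fintype V] {G : SimpleGraph V} {q r m : ℕ} (L : Layout G q r m)
  {ident : V → ℕ}

open Classical in
theorem card_filter_not_isHigh_adj_le (G : SimpleGraph V) (q : ℕ) :
    (Finset.univ.filter fun p : V × V => ¬ IsHigh G q p.1 ∧ G.Adj p.1 p.2).card ≤
      q * Fintype.card V := by
  refine (Finset.card_le_mul_card_image (f := Prod.fst) _ q fun u hu => ?_).trans
    (Nat.mul_le_mul_left _ (Finset.card_le_univ _))
  obtain ⟨p, hp, rfl⟩ := Finset.mem_image.1 hu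
  have hlow := (Finset.mem_filter.1 hp).2.1
  rw [IsHigh, not_le, Set.ncard_eq_toFinset_card] at hlow
  refine le_trans (Finset.card_le_card_of_injOn Prod.snd (fun p' hp' => ?_) ?_) hlow.le
  · simp only [Finset.coe_filter, Finset.mem_filter, Finset.mem_univ, true_and,
      Set.mem_ofPred_eq] at hp'
    simpa [← hp'.2] using hp'.1.2
  · intro a ha b hb hab
    simp only [Finset.coe_filter, Finset.mem_filter, Finset.mem_univ, true_and,
      Set.mem_ofPred_eq] at ha hb
    exact Prod.ext (ha.2.trans hb.2.symm) hab

theorem card_map_le : (L.map ident).card ≤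
    3 * Fintype.card V + 2 * ((clusterRoots G q r).card * Fintype.card V) +
      q * Fintype.card V := by
  classical
  have hroots : (clusterRoots G q r ×ˢ (Finset.univ : Finset V)).card =
      (clusterRoots G q r).card * Fintype.card V := Finset.card_product _ _
  have hunion {A B : ClusterMap} {a b : ℕ} (hA : A.card ≤ a) (hB : B.card ≤ b) :
      (A ∪ B).card ≤ a + b := (Finset.card_union_le A B).trans (Nat.add_le_add hA hB)
  refine (hunion (hunion (hunion (hunion (hunion
    (Finset.card_image_le (s := Finset.univ))
    (Finset.card_image_le (s := Finset.univ)))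
    (Finset.card_image_le.trans (Finset.card_filter_le _ _)))
    (Finset.card_image_le.trans ((Finset.card_filter_le _ _).trans_eq hroots)))
    (Finset.card_image_le.trans_eq hroots))
    (Finset.card_image_le.trans (card_filter_not_isHigh_adj_le G q))).trans_eq ?_
  rw [Finset.card_univ]
  ring

theorem card_rows_le (w : V) :
    (L.certificate ident w).rows.card ≤ (Fintype.card V / m + 1) * Fintype.card V := by
  classical
  refine Finset.card_image_le.trans ((Finset.card_le_card
    (t := {z | L.group z = L.colour w}.toFinite.toFinset ×ˢ Finset.univ) fun p hp => ?_).trans ?_)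
  · simpa using (Finset.mem_filter.1 hp).2.1
  · rw [Finset.card_product, ← Set.ncard_eq_toFinset_card, Finset.card_univ]
    exact Nat.mul_le_mul_right _ (L.ncard_group_le _)

theorem entryEmbedding_lt_of_mem {s : ℕ} (hident : ∀ u, ident u < 2 ^ s)
    (hcard : Fintype.card V + 7 ≤ 2 ^ s) {w : V} {e : MapEntry ⊕ ℕ × ℕ}
    (he : e ∈ (L.certificate ident w).map.disjSum (L.certificate ident w).rows) :
    Certificate.entryEmbedding e < 2 ^ (4 * s) := by
  classical
  have hzero : 0 < 2 ^ s := by lia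
  apply Certificate.entryEmbedding_lt
  simp only [Finset.mem_disjSum, certificate, map, Finset.mem_union, Finset.mem_image] at he
  rcases he with ⟨_, (((((⟨u, -, rfl⟩ | ⟨u, -, rfl⟩) | ⟨u, -, rfl⟩) | ⟨p, hp, rfl⟩) |
    ⟨p, -, rfl⟩) | ⟨p, -, rfl⟩), rfl⟩ | ⟨_, ⟨p, -, rfl⟩, rfl⟩
  · refine ⟨⟨hzero, hident u⟩, ?_, hzero⟩
    simp only [Certificate.entry]
    split_ifs
    exacts [hident _, hzero]
  · exact ⟨⟨by simp only [Certificate.entry]; lia, hident u⟩,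
      (dist_lt_card (linkGraph G q r) u _).trans_le (by lia), hzero⟩
  · exact ⟨⟨by simp only [Certificate.entry]; lia, hident u⟩, hident _, hzero⟩
  · exact ⟨⟨by simp only [Certificate.entry]; lia, hident _⟩,
      (clusterFar_lt_card (Finset.mem_filter.1 hp).2).trans_le (by lia), hident _⟩
  · exact ⟨⟨by simp only [Certificate.entry]; lia, hident _⟩,
      (clusterReach_le_card p.1 p.2).trans_lt (by lia), hident _⟩
  · exact ⟨⟨by simp only [Certificate.entry]; lia, hident _⟩, hident _, hzero⟩
  · exact ⟨⟨by simp only [Certificate.entry]; lia, hident _⟩, hident _, hzero⟩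

end Layout

/-- The size of the certificates on `n` vertices with identifiers at most `n ^ c`: there are at
most `23 * (log₂ n + 1) * √n * n` entries, on at most `(8 * c + 33) * (log₂ n + 1)` bits each. -/
def certSize (c n : ℕ) : ℕ :=
  23 * ((Nat.log 2 n + 1) * Nat.sqrt n) * n * ((8 * c + 33) * (Nat.log 2 n + 1))

theorem lt_two_pow_of_le_pow {a c n : ℕ} (h : a ≤ n ^ c) :
    a < 2 ^ ((Nat.log 2 n + 1) * (c + 1) + 3) := by
  refine (h.trans (Nat.pow_le_pow_left (Nat.lt_pow_succ_log_self one_lt_two n).le c)).trans_lt ?_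
  rw [← pow_mul]
  exact Nat.pow_lt_pow_right one_lt_two (by lia)

theorem add_seven_le_two_pow (c n : ℕ) : n + 7 ≤ 2 ^ ((Nat.log 2 n + 1) * (c + 1) + 3) := by
  have hn : n < 2 ^ (Nat.log 2 n + 1) := Nat.lt_pow_succ_log_self one_lt_two n
  have hpow : 2 ^ (Nat.log 2 n + 1) ≤ 2 ^ ((Nat.log 2 n + 1) * (c + 1)) :=
    Nat.pow_le_pow_right two_pos (Nat.le_mul_of_pos_right _ c.succ_pos)
  rw [pow_add]
  lia

theorem Layout.card_entries_le {V : Type} [Fintype V] {G : SimpleGraph V} {r : ℕ} (hr : 1 ≤ r)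
    (L : Layout G (Nat.sqrt (Fintype.card V)) r (colorCount (Fintype.card V))) (ident : V → ℕ)
    (w : V) :
    ((L.certificate ident w).map.disjSum (L.certificate ident w).rows).card ≤
      23 * ((Nat.log 2 (Fintype.card V) + 1) * Nat.sqrt (Fintype.card V)) * Fintype.card V := by
  rw [Finset.card_disjSum]
  refine (Nat.add_le_add L.card_map_le (L.card_rows_le w)).trans ?_
  have hroots := card_clusterRoots_mul_le (G := G) (q := Nat.sqrt (Fintype.card V)) hr
  have hdiv := div_colorCount_le (Fintype.card V)
  have hq : 0 < Nat.sqrt (Fintype.card V) := Nat.sqrt_pos.2 (Fintype.card_pos_iff.2 ⟨w⟩)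
  have hle := Nat.sqrt_le_add (Fintype.card V)
  have hmul := Nat.le_mul_of_pos_left (Nat.sqrt (Fintype.card V))
    (Nat.log 2 (Fintype.card V)).succ_pos
  generalize (Nat.log 2 (Fintype.card V) + 1) * Nat.sqrt (Fintype.card V) = X at *
  generalize Fintype.card V / colorCount (Fintype.card V) = d at *
  generalize Nat.sqrt (Fintype.card V) = q at *
  generalize (clusterRoots G q r).card = b at *
  generalize Fintype.card V = n at *
  have hb : b ≤ q + 2 := Nat.le_of_mul_le_mul_right (by nlinarith : b * q ≤ (q + 2) * q) hq
  calc 3 * n + 2 * (b * n) + q * n + (d + 1) * n = (3 + 2 * b + q + (d + 1)) * n := by ring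
    _ ≤ 23 * X * n := Nat.mul_le_mul_right _ (by lia)

theorem Layout.length_encode_certificate_le {V : Type} [Fintype V] {G : SimpleGraph V} {c r : ℕ}
    (hr : 1 ≤ r) (L : Layout G (Nat.sqrt (Fintype.card V)) r (colorCount (Fintype.card V)))
    {ident : V → ℕ} (hident : ∀ u, ident u ≤ Fintype.card V ^ c) (w : V) :
    (L.certificate ident w).encode.length ≤ certSize c (Fintype.card V) := by
  refine (length_encodeFinset_le fun e he => L.entryEmbedding_lt_of_mem
    (fun u => lt_two_pow_of_le_pow (hident u)) (add_seven_le_two_pow c _) he).trans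
    (Nat.mul_le_mul (L.card_entries_le hr ident w) ?_)
  have : 1 ≤ Nat.log 2 (Fintype.card V) + 1 := by lia
  nlinarith

theorem log_add_one_le {n : ℕ} (hn : 2 ≤ n) : (Nat.log 2 n + 1 : ℝ) ≤ 4 * Real.log n := by
  have hpow : (2 : ℝ) ^ Nat.log 2 n ≤ n := by exact_mod_cast Nat.pow_log_le_self 2 (by lia)
  have hlog := Real.log_le_log (by positivity) hpow
  rw [Real.log_pow] at hlog
  have htwo : (1 / 2 : ℝ) ≤ Real.log 2 := by linarith [Real.log_two_gt_d9]
  have hone : (1 : ℝ) ≤ Nat.log 2 n := by exact_mod_cast Nat.log_pos one_lt_two hn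
  nlinarith

theorem isBigO_certSize (c : ℕ) : (fun n : ℕ => (certSize c n : ℝ)) =O[Filter.atTop]
    fun n : ℕ => (n : ℝ) ^ (3 / 2 : ℝ) * Real.log n ^ 2 := by
  refine Asymptotics.IsBigO.of_bound (16 * (23 * (8 * c + 33))) ?_
  filter_upwards [Filter.eventually_ge_atTop 2] with n hn
  have hpow : (n : ℝ) ^ (3 / 2 : ℝ) = Real.sqrt n * n := by
    rw [show (3 / 2 : ℝ) = 1 / 2 + 1 by norm_num, Real.rpow_add (by positivity), Real.rpow_one,
      Real.sqrt_eq_rpow]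
  have hlog := log_add_one_le hn
  rw [Real.norm_of_nonneg (by positivity), Real.norm_of_nonneg (by positivity), hpow]
  calc (certSize c n : ℝ)
      = 23 * (8 * c + 33) * (Nat.log 2 n + 1 : ℝ) ^ 2 * Nat.sqrt n * n := by
        rw [certSize]
        push_cast
        ring
    _ ≤ 23 * (8 * c + 33) * (4 * Real.log n) ^ 2 * Real.sqrt n * n := by
        gcongr
        exact Real.nat_sqrt_le_real_sqrt
    _ = _ := by ring

/-! ### The local certifications -/

theorem hasLocalCertification_of_one_le (c : ℕ) {r : ℕ} (hr : 1 ≤ r) :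
    HasLocalCertification c (certSize c) (r + 1) (IsInducedPathFree (4 * r + 3)) := by
  refine hasLocalCertification_of_encoding Certificate.encode (LocalView.Verifies r) ?_ ?_
  · intro V _ G ident hident hfree
    rw [← not_not (a := IsInducedPathFree _ V G), not_isInducedPathFree_iff (by lia),
      not_exists] at hfree
    obtain ⟨L⟩ := Layout.nonempty G (Nat.sqrt (Fintype.card V)) r
      (colorCount_pos (Fintype.card V)) (mul_colorCount_mul_pow_lt _)
    exact ⟨L.certificate ident, L.length_encode_certificate_le hr fun u => (hident.2 u).2,
      fun v => ⟨L.certificate ident v, mk_mem_labels (by simp),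
        L.accepts hident.1 hr (fun u => (hident.2 u).1) hfree v⟩⟩
  · intro V _ G ident hident F hverifies
    exact isInducedPathFree_of_forall_verifies hr hident hverifies

theorem isInducedPathFree_three_iff {V : Type} {G : SimpleGraph V} :
    IsInducedPathFree 3 V G ↔
      ∀ u v, G.Adj u v → insert u (G.neighborSet u) = insert v (G.neighborSet v) := by
  rw [← not_iff_not, not_isInducedPathFree_iff three_pos]
  constructor
  · rintro ⟨x, hx⟩ hclosed
    have h₀₁ := (hx 0 1 (by lia) (by lia)).2.2 rfl
    have h₁₂ := (hx 1 2 (by lia) (by lia)).2.2 rfl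
    have h₀₂ := hx 0 2 (by lia) (by lia)
    have hmem : x 2 ∈ insert (x 0) (G.neighborSet (x 0)) := hclosed _ _ h₀₁ ▸ Or.inr h₁₂
    rcases hmem with h | h
    · exact h₀₂.1 h.symm
    · exact absurd (h₀₂.2.1 h) (by lia)
  · intro hclosed
    contrapose! hclosed with hfree
    have hsub (u v) (huv : G.Adj u v) :
        insert u (G.neighborSet u) ⊆ insert v (G.neighborSet v) := by
      rintro w (rfl | huw)
      · exact Or.inr huv.symm
      by_contra! hw
      rw [Set.mem_insert_iff, not_or] at hw
      refine hfree (fun i => if i = 0 then w else if i = 1 then u else v) fun i j hij hj => ?_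
      obtain ⟨rfl, rfl⟩ | ⟨rfl, rfl⟩ | ⟨rfl, rfl⟩ :
          (i = 0 ∧ j = 1) ∨ (i = 0 ∧ j = 2) ∨ (i = 1 ∧ j = 2) := by lia
      · simp [huw.ne', huw.symm]
      · simpa [G.adj_comm] using hw
      · simp [huv, huv.ne]
    exact fun u v huv => (hsub u v huv).antisymm (hsub v u huv.symm)

/-- The verification algorithm at radius `1`: the certificate of a vertex is its closed
neighbourhood, and neighbours have the same certificate. -/
def LocalView.VerifiesClosedNeighborhood (W : LocalView) : Prop :=
  ∃ S, (W.center, encodeFinset (.refl ℕ) S) ∈ W.labels ∧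
    (S : Set ℕ) = insert W.center {b | (W.center, b) ∈ W.edges} ∧
    ∀ w T, (W.center, w) ∈ W.edges → (w, encodeFinset (.refl ℕ) T) ∈ W.labels → T = S

theorem verifiesClosedNeighborhood_iff {V : Type} {G : SimpleGraph V} {ident : V → ℕ}
    (hident : Function.Injective ident) {F : V → Finset ℕ} {v : V} :
    (localView G ident (encodeFinset (.refl ℕ) ∘ F) 1 v).VerifiesClosedNeighborhood ↔
      (F v : Set ℕ) = ident '' insert v (G.neighborSet v) ∧ ∀ w, G.Adj v w → F w = F v := by
  have hlabel {w : V} {S : Finset ℕ} (h : (ident w, encodeFinset (.refl ℕ) S) ∈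
      (localView G ident (encodeFinset (.refl ℕ) ∘ F) 1 v).labels) : S = F w := by
    obtain ⟨w', -, hw', hS⟩ := exists_of_mem_labels h
    exact (hident hw' ▸ encodeFinset_injective _ hS).symm
  have hedges : {b | (ident v, b) ∈ (localView G ident (encodeFinset (.refl ℕ) ∘ F) 1 v).edges} =
      ident '' G.neighborSet v := Set.ext fun b => by
    exact center_mem_edges_iff (cert := encodeFinset (.refl ℕ) ∘ F) (d := 0) hident
  rw [Set.image_insert_eq, ← hedges]
  constructor
  · rintro ⟨S, hS, hneighbours, hagree⟩
    obtain rfl := hlabel hS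
    refine ⟨hneighbours, fun w hw => hagree (ident w) (F w) ?_ (mk_mem_labels ?_)⟩
    · exact hedges.ge ⟨w, hw, rfl⟩
    · exact (SimpleGraph.edist_eq_one_iff_adj.2 hw).le
  · rintro ⟨hneighbours, hagree⟩
    refine ⟨F v, mk_mem_labels (by simp), hneighbours, fun b T hb hT => ?_⟩
    obtain ⟨w, hw, rfl⟩ := hedges.le hb
    exact (hlabel hT).trans (hagree w hw)

theorem length_encodeFinset_refl_le {c n : ℕ} (hn : 0 < n) {S : Finset ℕ} (hcard : S.card ≤ n)
    (hS : ∀ a ∈ S, a ≤ n ^ c) : (encodeFinset (.refl ℕ) S).length ≤ certSize c n := by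
  refine (length_encodeFinset_le fun a ha => lt_two_pow_of_le_pow (hS a ha)).trans
    (Nat.mul_le_mul (hcard.trans (Nat.le_mul_of_pos_left n ?_)) ?_)
  · have := Nat.sqrt_pos.2 hn
    positivity
  · nlinarith [Nat.zero_le (Nat.log 2 n), Nat.zero_le (Nat.log 2 n * c)]

theorem hasLocalCertification_one (c : ℕ) :
    HasLocalCertification c (certSize c) 1 (IsInducedPathFree 3) := by
  refine hasLocalCertification_of_encoding (encodeFinset (.refl ℕ))
    LocalView.VerifiesClosedNeighborhood ?_ ?_
  · intro V _ G ident hident hfree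
    let closedNeighborhood (v : V) := (ident '' insert v (G.neighborSet v)).toFinite.toFinset
    refine ⟨closedNeighborhood, fun v => ?_, fun v => ?_⟩
    · refine length_encodeFinset_refl_le (Fintype.card_pos_iff.2 ⟨v⟩) ?_ fun a ha => ?_
      · rw [← Set.ncard_eq_toFinset_card _ (Set.toFinite _),
          Set.ncard_image_of_injective _ hident.1, ← Nat.card_eq_fintype_card]
        exact Set.ncard_le_card _
      · obtain ⟨u, -, rfl⟩ := (Set.Finite.mem_toFinset _).1 ha
        exact (hident.2 u).2
    · refine (verifiesClosedNeighborhood_iff hident.1).2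
        ⟨Set.Finite.coe_toFinset _, fun w hw => ?_⟩
      simp only [closedNeighborhood, isInducedPathFree_three_iff.1 hfree v w hw]
  · intro V _ G ident hident F hverifies
    simp only [verifiesClosedNeighborhood_iff hident] at hverifies
    refine isInducedPathFree_three_iff.2 fun u v huv => hident.image_injective ?_
    rw [← (hverifies u).1, ← (hverifies v).1, (hverifies u).2 v huv]

theorem mainTheorem5 (c : ℕ) :
    ∃ s : ℕ → ℕ,
      ((fun n : ℕ => (s n : ℝ)) =O[Filter.atTop]
        fun n : ℕ => (n : ℝ) ^ (3 / 2 : ℝ) * Real.log n ^ 2) ∧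
      ∀ k : ℕ, 1 ≤ k → HasLocalCertification c s k (IsInducedPathFree (4 * k - 1)) := by
  refine ⟨certSize c, isBigO_certSize c, fun k hk => ?_⟩
  obtain ⟨r, rfl⟩ := Nat.exists_eq_add_of_le' hk
  rcases Nat.eq_zero_or_pos r with rfl | hr
  · exact hasLocalCertification_one c
  · exact hasLocalCertification_of_one_le c hr
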